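/- Let $1\le M\le N$ be integers and let $a=(a_1,\dots,a_M)$, $b=(b_0,b_1,\dots,b_N)$ have positive real entries. For $n\ge 0$ and $c=(c_1,\dots,c_n)$ with positive entries and $\Re(w)>0$, let $\zeta_n(s,w\,|\,c)$ be the Barnes zeta function $$\zeta_n(s,w\,|\,c)=\frac1{\Gamma(s)}\int_0^\infty t^{s-1}e^{-wt}\prod_{j=1}^n\bigl(1-e^{-c_jt}\bigr)^{-1}\,dt,\qquad \Re(s)>n,$$ continued analytically in $s$ to $\mathbb{C}\setminus\{1,\dots,n\}$, and let $L_n(w\,|\,c)=\partial_s\zeta_n(s,w\,|\,c)|_{s=0}$. For a function $f$ put $$(\mathcal S_Nf)(q\,|\,b)=\sum_{p=0}^N(-1)^p\sum_{1\le k_1<\cdots<k_p\le N}f\bigl(q+b_0+b_{k_1}+\cdots+b_{k_p}\bigr),$$ and write $(\mathcal S_NL_n)(q\,|\,c,b)$ when $f=L_n(\,\cdot\,|\,c)$. There is a unique probability distribution on $(0,1]$, the Barnes beta distribution, such that a random variable $\beta_{M,N}(a,b)$ with this distribution satisfies $$\mathbf E\bigl[\beta_{M,N}(a,b)^q\bigr]=\exp\Bigl((\mathcal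 S_NL_M)(q\,|\,a,b)-(\mathcal S_NL_M)(0\,|\,a,b)\Bigr),\qquad \Re(q)>-b_0 .$$ Let $1\le i\le M$ and let $\hat a_i=(a_1,\dots,a_{i-1},a_{i+1},\dots,a_M)$. Then the power series $$\mathcal L^{(i)}_{M,N}(x\,|\,a,b)=\sum_{k=0}^\infty\frac{(-x)^k}{k!}\exp\Bigl(-\sum_{l=0}^{k-1}(\mathcal S_NL_{M-1})(l a_i\,|\,\hat a_i,b)\Bigr)$$ has infinite radius of convergence, and for every $x>0$ $$\mathbf E\Bigl[\exp\bigl(-x\,\beta_{M,N}(a,b)^{a_i}\bigr)\Bigr]=\mathcal L^{(i)}_{M,N}(x\,|\,a,b).$$ In particular, $\mathcal L^{(i)}_{M,N}(x\,|\,a,b)$ is real and strictly positive for every $x>0$. -/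

import Mathlib

open MeasureTheory Set

noncomputable section

/-- The function `f(t) = t ^ M * ∏ j, (1 - exp (-a j t))⁻¹` attached to `a = (a 1, …, a M)`. -/
def barnesF {M : ℕ} (a : Fin M → ℝ) (t : ℝ) : ℝ :=
  t ^ M * ∏ j, (1 - Real.exp (-(a j * t)))⁻¹

/-- The integral that defines the Barnes zeta function `ζ_M(s, w | a)` for `Re s > M`, `Re w > 0`:
`Γ(s)⁻¹ ∫₀^∞ t ^ (s - 1) e ^ (-w t) f(t) dt / t ^ M`. -/
def barnesZetaIntegral {M : ℕ} (a : Fin M → ℝ) (w s : ℂ) : ℂ :=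
  (Complex.Gamma s)⁻¹ *
    ∫ t in Ioi (0 : ℝ),
      (t : ℂ) ^ (s - 1) * Complex.exp (-(w * (t : ℂ))) * ((barnesF a t / t ^ M : ℝ) : ℂ)

/-- `Z` is a holomorphic continuation of `s ↦ ζ_M(s, w | a)` from the half-plane `Re s > M` to
`ℂ` minus the points `1, …, M`. This set is open and connected, so `Z` is unique on it. -/
def IsBarnesZetaContinuation {M : ℕ} (a : Fin M → ℝ) (w : ℂ) (Z : ℂ → ℂ) : Prop :=
  DifferentiableOn ℂ Z {s : ℂ | ∀ k ∈ Finset.Icc 1 M, s ≠ (k : ℂ)} ∧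
    ∀ s : ℂ, (M : ℝ) < s.re → Z s = barnesZetaIntegral a w s

/-- The Barnes zeta function `s ↦ ζ_M(s, w | a)`, continued to `ℂ` minus `1, …, M` (`Re w > 0`). -/
def barnesZeta {M : ℕ} (a : Fin M → ℝ) (w : ℂ) : ℂ → ℂ :=
  Classical.epsilon (IsBarnesZetaContinuation a w)

/-- The Barnes multiple log-gamma function `L_M(w | a) = ∂_s ζ_M(s, w | a)` at `s = 0`
(`Re w > 0`). -/
def barnesLogGamma {M : ℕ} (a : Fin M → ℝ) (w : ℂ) : ℂ :=
  deriv (barnesZeta a w) 0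

/-- The operator `𝒮_N`, for `b = (b 0, b 1, …, b N)`:
the alternating sum of `f (q + b 0 + b k₁ + ⋯ + b k_p)` over all subsets `{k₁ < ⋯ < k_p}` of
`{1, …, N}`, with sign `(-1) ^ p`. -/
def barnesS {N : ℕ} (b : Fin (N + 1) → ℝ) (f : ℂ → ℂ) (q : ℂ) : ℂ :=
  ∑ K : Finset (Fin N), (-1 : ℂ) ^ K.card * f (q + (b 0 : ℂ) + ∑ k ∈ K, (b k.succ : ℂ))

/-- `η_{M,N}(q | a, b) = exp ((𝒮_N L_M)(q | a, b) - (𝒮_N L_M)(0 | a, b))`. -/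
def barnesEta {M N : ℕ} (a : Fin M → ℝ) (b : Fin (N + 1) → ℝ) (q : ℂ) : ℂ :=
  Complex.exp (barnesS b (barnesLogGamma a) q - barnesS b (barnesLogGamma a) 0)

/-- `μ` is the Barnes beta distribution `β_{M,N}(a, b)`: the probability distribution on `(0, 1]`
with Mellin transform `E[β ^ q] = η_{M,N}(q | a, b)` for `Re q > -b 0`. -/
structure IsBarnesBeta {M N : ℕ} (a : Fin M → ℝ) (b : Fin (N + 1) → ℝ) (μ : Measure ℝ) :
    Prop where
  isProbabilityMeasure : IsProbabilityMeasure μ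
  ae_mem : ∀ᵐ t ∂μ, t ∈ Ioc (0 : ℝ) 1
  integrable_cpow : ∀ q : ℂ, -b 0 < q.re → Integrable (fun t : ℝ => (t : ℂ) ^ q) μ
  mellin_eq : ∀ q : ℂ, -b 0 < q.re → ∫ t : ℝ, (t : ℂ) ^ q ∂μ = barnesEta a b q

/-- `exp (- ∑_{l < k} (𝒮_N L_{M-1})(l a_i | â_i, b))`, where `M - 1` is written `m` and `â_i` is
`a` without its entry `a i`. -/
def barnesMoment {m N : ℕ} (a : Fin (m + 1) → ℝ) (b : Fin (N + 1) → ℝ) (i : Fin (m + 1))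
    (k : ℕ) : ℂ :=
  Complex.exp (-∑ l ∈ Finset.range k,
    barnesS b (barnesLogGamma (fun j : Fin m => a (i.succAbove j))) ((l : ℂ) * (a i : ℂ)))

/-- The coefficient of `x ^ k` in the series `ℒ^{(i)}_{M,N}(x | a, b)`. -/
def barnesLaplaceCoeff {m N : ℕ} (a : Fin (m + 1) → ℝ) (b : Fin (N + 1) → ℝ) (i : Fin (m + 1))
    (k : ℕ) : ℂ :=
  (-1) ^ k / (k.factorial : ℂ) * barnesMoment a b i k

/-- The sum `ℒ^{(i)}_{M,N}(x | a, b) = ∑ k, (-x) ^ k / k! * exp (- ∑_{l < k} …)`. -/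
def barnesLaplace {m N : ℕ} (a : Fin (m + 1) → ℝ) (b : Fin (N + 1) → ℝ) (i : Fin (m + 1))
    (x : ℂ) : ℂ :=
  ∑' k : ℕ, (-x) ^ k / (k.factorial : ℂ) * barnesMoment a b i k

end

open Filter Asymptotics Topology

noncomputable section

/-! Since `X = β ^ a_i` takes values in `(0, 1]`, the exponential series of `exp (-x X)` may be
integrated term by term, and `E[X ^ k] = η(k a_i)`. These moments are the coefficients of `ℒ`:
multiplying the kernel `∏ (1 - e^{-a_j t})⁻¹` by `1 - e^{-a_i t}` deletes its `i`-th factor, so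
`L_M(w) - L_M(w + a_i) = L_{M-1}(w | â_i)` (`barnesLogGamma_sub_add`), and the sum over `l < k`
telescopes (`barnesMoment_eq_barnesEta`). Moments of modulus at most 1 give the infinite radius, and
the expectation of a positive function gives positivity.

The substance is the existence of `β`. Applying `𝒮_N` to `e^{-wt}` produces the factor `e^{-b₀t} ∏
(1 - e^{-b_k t})`, and differentiating at `s = 0` yields `(𝒮_N L_M)(q) - (𝒮_N L_M)(0) = ∫₀^∞
(e^{-qt} - 1) g(t) dt/t` with `g = barnesLevy a b ≥ 0` (`integral_barnesLevy`). This is a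
Lévy–Khintchine exponent for `-log β`. For `M ≤ N` the function `g` has a finite limit `C` at `0+`;
subtracting `C e^{-lt}/t`, the Lévy density of a Gamma law, leaves a nonnegative density of finite
mass, which belongs to a compound Poisson law. The convolution of the two laws is the law of `-log
β` (`exists_law_neg_log_barnesBeta`). Uniqueness holds because `η` on the imaginary axis is the
characteristic function of `log β`.

The zeta functions are continued by subtracting Taylor polynomials times `e^{-t}` under the Mellin
integral (`exists_continuation_inv_Gamma_mul_mellin`). Identities between integrals for large `Re s`
are carried to derivatives at `0` by `deriv_zero_eq_of_eq_of_lt_re`. -/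

/-! ### Laplace and Gamma integrals with complex rate -/

/-- Laplace integrals are holomorphic in the right half-plane. -/
theorem differentiableOn_laplace_integral {h : ℝ → ℂ}
    (hh : ∀ σ : ℝ, 0 < σ → IntegrableOn (fun t : ℝ => h t * Complex.exp (-((σ : ℂ) * t))) (Ioi 0)) :
    DifferentiableOn ℂ (fun r : ℂ => ∫ t in Ioi (0 : ℝ), h t * Complex.exp (-(r * t)))
      {r : ℂ | 0 < r.re} := by
  have hmeas : AEStronglyMeasurable h (volume.restrict (Ioi 0)) := by
    have h1 := (hh 1 one_pos).aestronglyMeasurable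
    have h2 : Continuous fun t : ℝ => Complex.exp (((1 : ℝ) : ℂ) * t) := by fun_prop
    refine (h1.mul h2.aestronglyMeasurable).congr (Eventually.of_forall fun t => ?_)
    simp only [Pi.mul_apply, mul_assoc, ← Complex.exp_add]
    simp
  intro r₀ hr₀
  replace hr₀ : 0 < r₀.re := hr₀
  -- On the ball of radius `2σ` around `r₀` one has `Re r ≥ 2σ`. Half of that decay absorbs the
  -- factor `t` from the derivative, via `t ≤ σ⁻¹ e^{σt}`; the other half gives the integrable
  -- bound.
  set σ : ℝ := r₀.re / 4 with hσ
  have hσ0 : 0 < σ := by positivity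
  have key : ∀ (r : ℂ) (τ : ℝ), τ ≤ r.re → ∀ t ∈ Ioi (0 : ℝ),
      ‖h t * Complex.exp (-(r * t))‖ ≤ ‖h t * Complex.exp (-((τ : ℂ) * t))‖ := by
    intro r τ hr t ht
    simp only [norm_mul, Complex.norm_exp, Complex.neg_re, Complex.re_mul_ofReal,
      Complex.ofReal_re]
    have : τ * t ≤ r.re * t := mul_le_mul_of_nonneg_right hr (le_of_lt ht)
    gcongr
  have hm : ∀ r : ℂ, AEStronglyMeasurable (fun t : ℝ => h t * Complex.exp (-(r * t)))
      (volume.restrict (Ioi 0)) := fun r =>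
    hmeas.mul (by fun_prop : Continuous fun t : ℝ => Complex.exp (-(r * t))).aestronglyMeasurable
  have main := hasDerivAt_integral_of_dominated_loc_of_deriv_le (𝕜 := ℂ)
    (μ := volume.restrict (Ioi (0 : ℝ)))
    (F := fun (r : ℂ) (t : ℝ) => h t * Complex.exp (-(r * t)))
    (F' := fun (r : ℂ) (t : ℝ) => h t * (Complex.exp (-(r * t)) * -(t : ℂ)))
    (x₀ := r₀) (s := Metric.ball r₀ (2 * σ))
    (bound := fun t => σ⁻¹ * ‖h t * Complex.exp (-((σ : ℂ) * t))‖)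
    (Metric.ball_mem_nhds _ (by positivity)) (Eventually.of_forall hm) ?_ ?_ ?_ ?_ ?_
  · exact main.2.differentiableAt.differentiableWithinAt
  · refine Integrable.mono (hh _ hr₀) (hm r₀) ?_
    filter_upwards [self_mem_ae_restrict measurableSet_Ioi] with t ht
    exact key _ _ le_rfl t ht
  · refine ((hm r₀).mul (by fun_prop : Continuous fun t : ℝ => -(t : ℂ)).aestronglyMeasurable).congr
      (Eventually.of_forall fun t => ?_)
    simp [mul_assoc]
  · filter_upwards [self_mem_ae_restrict measurableSet_Ioi] with t ht r hr
    have ht0 : (0 : ℝ) < t := ht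
    have hre : 2 * σ ≤ r.re := by
      have h1 : |(r - r₀).re| < 2 * σ :=
        (Complex.abs_re_le_norm _).trans_lt (by simpa [dist_eq_norm] using hr)
      rw [Complex.sub_re, abs_lt] at h1
      linarith [h1.1]
    have h1 := key r (2 * σ) hre t ht
    have h2 : t ≤ σ⁻¹ * Real.exp (σ * t) := by
      rw [inv_mul_eq_div, le_div_iff₀ hσ0]
      linarith [Real.add_one_le_exp (σ * t)]
    calc ‖h t * (Complex.exp (-(r * t)) * -(t : ℂ))‖
        = ‖h t * Complex.exp (-(r * t))‖ * t := by
          simp [abs_of_pos ht0, mul_assoc]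
      _ ≤ ‖h t * Complex.exp (-(((2 * σ : ℝ) : ℂ) * t))‖ * (σ⁻¹ * Real.exp (σ * t)) := by
          gcongr
      _ = σ⁻¹ * ‖h t * Complex.exp (-((σ : ℂ) * t))‖ := by
          simp only [norm_mul, Complex.norm_exp, Complex.neg_re, Complex.re_mul_ofReal,
            Complex.ofReal_re]
          have : Real.exp (-(σ * t)) = Real.exp (-(2 * σ * t)) * Real.exp (σ * t) := by
            rw [← Real.exp_add]; ring_nf
          rw [this]; ring
  · exact ((hh σ hσ0).norm.const_mul _)
  · refine Eventually.of_forall fun t r _ => ?_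
    have h1 : HasDerivAt (fun r : ℂ => -(r * t)) (-(t : ℂ)) r := by
      simpa using! ((hasDerivAt_id r).mul_const (t : ℂ)).neg
    exact h1.cexp.const_mul _

theorem integrableOn_cpow_mul_exp_neg_mul_Ioi {a : ℂ} (ha : 0 < a.re) {r : ℂ} (hr : 0 < r.re) :
    IntegrableOn (fun t : ℝ => (t : ℂ) ^ (a - 1) * Complex.exp (-(r * t))) (Ioi 0) := by
  have := mellinConvergent_of_isBigO_rpow_exp (a := r.re) (b := 0) (s := a) hr
    (f := fun t : ℝ => Complex.exp (-(r * t)))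
    ((by fun_prop : Continuous _).continuousOn.locallyIntegrableOn measurableSet_Ioi)
    (IsBigO.of_bound 1 (Eventually.of_forall fun t => by
      simp [Complex.norm_exp])) ?_ ha
  · exact this
  · have h1 : Continuous fun t : ℝ => Complex.exp (-(r * t)) := by fun_prop
    simpa using (h1.tendsto 0).isBigO_one ℝ |>.mono nhdsWithin_le_nhds

/-- The Gamma integral with complex rate. -/
theorem integral_cpow_mul_exp_neg_mul_Ioi_of_re_pos {a : ℂ} (ha : 0 < a.re) {r : ℂ}
    (hr : 0 < r.re) :
    ∫ t in Ioi (0 : ℝ), (t : ℂ) ^ (a - 1) * Complex.exp (-(r * t)) =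
      (1 / r) ^ a * Complex.Gamma a := by
  have hopen : IsOpen {r : ℂ | 0 < r.re} := isOpen_lt continuous_const Complex.continuous_re
  have h1 : DifferentiableOn ℂ (fun r : ℂ => ∫ t in Ioi (0 : ℝ),
      (t : ℂ) ^ (a - 1) * Complex.exp (-(r * t))) {r : ℂ | 0 < r.re} :=
    differentiableOn_laplace_integral fun σ hσ =>
      integrableOn_cpow_mul_exp_neg_mul_Ioi ha (by simpa using hσ)
  have h2 : DifferentiableOn ℂ (fun r : ℂ => (1 / r) ^ a * Complex.Gamma a)
      {r : ℂ | 0 < r.re} := by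
    intro r hr
    replace hr : 0 < r.re := hr
    have hr0 : r ≠ 0 := by rintro rfl; simp at hr
    have h3 : (1 / r) ∈ Complex.slitPlane := by
      left
      rw [one_div, Complex.inv_re]
      exact div_pos hr (Complex.normSq_pos.2 hr0)
    have h4 : DifferentiableAt ℂ (fun r : ℂ => 1 / r) r := by
      simpa using differentiableAt_inv hr0
    exact ((h4.cpow_const h3).mul_const _).differentiableWithinAt
  -- Identity theorem in `r`: the formula is known for real `r > 0`, and the points `1 + 1/(n+1)`
  -- accumulate at `1`.
  refine (h1.analyticOnNhd hopen).eqOn_of_preconnected_of_frequently_eq (h2.analyticOnNhd hopen)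
    (convex_halfSpace_re_gt 0).isPreconnected (z₀ := 1) (by simp) ?_ hr
  have h5 : Tendsto (fun n : ℕ => (((1 : ℝ) + 1 / ((n : ℝ) + 1) : ℝ) : ℂ)) atTop (𝓝[≠] 1) := by
    refine tendsto_nhdsWithin_iff.2 ⟨?_, Eventually.of_forall fun n => ?_⟩
    · have := (tendsto_one_div_add_atTop_nhds_zero_nat (𝕜 := ℝ)).const_add 1
      simpa [Function.comp_def] using (Complex.continuous_ofReal.tendsto _).comp this
    · have : (0 : ℝ) < 1 / ((n : ℝ) + 1) := by positivity
      simp only [mem_compl_iff, mem_singleton_iff]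
      intro h
      have h' := Complex.ofReal_injective (h.trans Complex.ofReal_one.symm)
      linarith
  refine h5.frequently (Frequently.of_forall fun n => ?_)
  exact Complex.integral_cpow_mul_exp_neg_mul_Ioi ha (by positivity)

/-! ### Gamma quotients and the behaviour of `1/Γ` at `0` -/

theorem inv_Gamma_eq_prod_mul_inv_Gamma_add (s : ℂ) (n : ℕ) :
    (Complex.Gamma s)⁻¹ = (∏ j ∈ Finset.range n, (s + j)) * (Complex.Gamma (s + n))⁻¹ := by
  induction n with
  | zero => simp
  | succ n ih =>
    rw [ih, Finset.prod_range_succ, Complex.one_div_Gamma_eq_self_mul_one_div_Gamma_add_one (s + n)]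
    push_cast
    ring_nf

/-- `Γ (s - M + k) / Γ s` extends holomorphically to the complement of `{1, …, M}`. -/
theorem exists_gamma_ratio (M k : ℕ) : ∃ R : ℂ → ℂ,
    DifferentiableOn ℂ R {s : ℂ | ∀ k ∈ Finset.Icc 1 M, s ≠ (k : ℂ)} ∧
    ∀ s : ℂ, 0 < (s - M + k).re → (∀ k ∈ Finset.Icc 1 M, s ≠ (k : ℂ)) →
      R s = (Complex.Gamma s)⁻¹ * Complex.Gamma (s - M + k) := by
  -- For `k ≤ M` the ratio is the inverse of a product whose zeros lie in `{1, …, M}`; for `k ≥ M`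
  -- it is a polynomial.
  rcases le_total k M with h | h
  · obtain ⟨n, rfl⟩ := Nat.exists_eq_add_of_le h
    have hne : ∀ s : ℂ, (∀ j ∈ Finset.Icc 1 (k + n), s ≠ (j : ℂ)) →
        ∏ j ∈ Finset.range n, (s - n + j) ≠ 0 := by
      intro s hs
      refine Finset.prod_ne_zero_iff.2 fun j hj => ?_
      have hj' := Finset.mem_range.1 hj
      have := hs (n - j) (Finset.mem_Icc.2 ⟨by omega, by omega⟩)
      rw [Nat.cast_sub hj'.le] at this
      intro h0
      exact this (by linear_combination h0)
    refine ⟨fun s => (∏ j ∈ Finset.range n, (s - n + j))⁻¹, ?_, ?_⟩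
    · exact DifferentiableOn.inv (by fun_prop) fun s hs => hne s hs
    · intro s h0 hs
      have e : s - ((k + n : ℕ) : ℂ) + k = s - n := by push_cast; ring
      rw [e] at h0 ⊢
      have h1 := inv_Gamma_eq_prod_mul_inv_Gamma_add (s - n) n
      rw [sub_add_cancel] at h1
      have h2 := Complex.Gamma_ne_zero_of_re_pos h0
      have h3 := hne s hs
      have h4 : (Complex.Gamma s)⁻¹ =
          (∏ j ∈ Finset.range n, (s - n + j))⁻¹ * (Complex.Gamma (s - n))⁻¹ := by
        rw [h1, inv_mul_cancel_left₀ h3]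
      rw [h4, mul_assoc, inv_mul_cancel₀ h2, mul_one]
  · obtain ⟨n, rfl⟩ := Nat.exists_eq_add_of_le h
    refine ⟨fun s => ∏ j ∈ Finset.range n, (s + j), by fun_prop, ?_⟩
    intro s h0 _
    have e : s - (M : ℂ) + ((M + n : ℕ) : ℂ) = s + n := by push_cast; ring
    rw [e] at h0 ⊢
    have h2 := Complex.Gamma_ne_zero_of_re_pos h0
    rw [inv_Gamma_eq_prod_mul_inv_Gamma_add s n, mul_assoc, inv_mul_cancel₀ h2, mul_one]

/-- As `1/Γ` vanishes at `0` with slope 1, the derivative at `0` of `Γ(s)⁻¹ F(s)` is simply `F 0`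
for `F` differentiable there. -/
theorem hasDerivAt_inv_Gamma_zero : HasDerivAt (fun s : ℂ => (Complex.Gamma s)⁻¹) 1 0 := by
  have h1 : (fun s : ℂ => (Complex.Gamma s)⁻¹) = fun s => s * (Complex.Gamma (s + 1))⁻¹ :=
    funext Complex.one_div_Gamma_eq_self_mul_one_div_Gamma_add_one
  have h2 : HasDerivAt (fun s : ℂ => (Complex.Gamma (s + 1))⁻¹)
      (deriv (fun s : ℂ => (Complex.Gamma s)⁻¹) (0 + 1)) 0 :=
    (Complex.differentiable_one_div_Gamma (0 + 1)).hasDerivAt.comp_add_const 0 1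
  rw [h1]
  simpa using! (hasDerivAt_id (0 : ℂ)).mul h2

theorem isOpen_compl_naturals_Icc (M : ℕ) :
    IsOpen {s : ℂ | ∀ k ∈ Finset.Icc 1 M, s ≠ (k : ℂ)} := by
  have : {s : ℂ | ∀ k ∈ Finset.Icc 1 M, s ≠ (k : ℂ)} =
      ⋂ k ∈ Finset.Icc 1 M, {s : ℂ | s ≠ (k : ℂ)} := by ext; simp
  rw [this]
  exact isOpen_biInter_finset fun k _ => isOpen_ne

/-! ### Analytic continuation of normalised Mellin transforms -/

theorem isBigO_exp_mul_sum_pow_atTop (c : ℕ → ℂ) (K : ℕ) :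
    (fun t : ℝ => Complex.exp (-(t : ℂ)) * ∑ k ∈ Finset.range K, c k * (t : ℂ) ^ k)
      =O[atTop] fun t : ℝ => Real.exp (-(1 / 2) * t) := by
  have h1 : (fun t : ℝ => Complex.exp (-(t : ℂ))) =O[atTop] fun t : ℝ => Real.exp (-t) :=
    IsBigO.of_bound 1 (Eventually.of_forall fun t => by simp [Complex.norm_exp])
  have h2 : (fun t : ℝ => ∑ k ∈ Finset.range K, c k * (t : ℂ) ^ k)
      =O[atTop] fun t : ℝ => Real.exp (1 / 2 * t) := by
    refine IsBigO.fun_sum fun k _ => IsBigO.const_mul_left ?_ _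
    refine IsBigO.trans (IsBigO.of_bound 1 (Eventually.of_forall fun t => ?_))
      (isLittleO_pow_exp_pos_mul_atTop k (by norm_num : (0 : ℝ) < 1 / 2)).isBigO
    simp
  refine (h1.mul h2).congr_right fun t => ?_
  rw [← Real.exp_add]
  ring_nf

theorem rpow_neg_neg_natCast (K : ℕ) :
    (fun t : ℝ => t ^ (-(-(K : ℝ)))) = fun t : ℝ => t ^ K := by
  funext t; rw [neg_neg, Real.rpow_natCast]

/-- Analytic continuation of `s ↦ Γ(s)⁻¹ ∫₀^∞ t ^ (s - M - 1) ψ(t) dt` for exponentially decaying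
`ψ` with an asymptotic expansion in powers of `t` at `0`. -/
theorem exists_continuation_inv_Gamma_mul_mellin (M : ℕ) {ψ : ℝ → ℂ} {ε : ℝ} (hε : 0 < ε)
    (hc : ContinuousOn ψ (Ioi 0)) (htop : ψ =O[atTop] fun t => Real.exp (-ε * t)) (c : ℕ → ℂ)
    (h0 : ∀ K : ℕ, (fun t : ℝ => ψ t -
      Complex.exp (-(t : ℂ)) * ∑ k ∈ Finset.range K, c k * (t : ℂ) ^ k) =O[𝓝[>] 0] (· ^ K)) :
    ∃ Z : ℂ → ℂ, DifferentiableOn ℂ Z {s : ℂ | ∀ k ∈ Finset.Icc 1 M, s ≠ (k : ℂ)} ∧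
      ∀ s : ℂ, (M : ℝ) < s.re → Z s = (Complex.Gamma s)⁻¹ * mellin ψ (s - M) := by
  set U : Set ℂ := {s : ℂ | ∀ k ∈ Finset.Icc 1 M, s ≠ (k : ℂ)} with hU
  have hUo : IsOpen U := isOpen_compl_naturals_Icc M
  -- `D K` is `O(t^K)` at `0`, so its Mellin transform is holomorphic for `Re z > -K`; each
  -- subtracted term `c k e^{-t} t^k` has the explicit transform `c k Γ(z + k)`.
  set D : ℕ → ℝ → ℂ := fun K t => ψ t -
    Complex.exp (-(t : ℂ)) * ∑ k ∈ Finset.range K, c k * (t : ℂ) ^ k with hD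
  have hDc : ∀ K, LocallyIntegrableOn (D K) (Ioi 0) := fun K =>
    (hc.sub (by fun_prop : Continuous fun t : ℝ => Complex.exp (-(t : ℂ)) *
      ∑ k ∈ Finset.range K, c k * (t : ℂ) ^ k).continuousOn).locallyIntegrableOn measurableSet_Ioi
  set δ : ℝ := min ε (1 / 2) with hδ
  have hδ0 : 0 < δ := lt_min hε (by norm_num)
  have hexp : ∀ r : ℝ, δ ≤ r → (fun t : ℝ => Real.exp (-r * t)) =O[atTop]
      fun t : ℝ => Real.exp (-δ * t) := fun r hr => by
    refine IsBigO.of_bound 1 ((eventually_ge_atTop 0).mono fun t ht => ?_)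
    simp only [Real.norm_eq_abs, Real.abs_exp, one_mul]
    exact Real.exp_le_exp.2 (by nlinarith)
  have hDtop : ∀ K, D K =O[atTop] fun t => Real.exp (-δ * t) := fun K =>
    (htop.trans (hexp _ (min_le_left _ _))).sub
      ((isBigO_exp_mul_sum_pow_atTop c K).trans (hexp _ (min_le_right _ _)))
  have hDbot : ∀ K : ℕ, D K =O[𝓝[>] 0] (fun t : ℝ => t ^ (-(-(K : ℝ)))) := fun K => by
    rw [rpow_neg_neg_natCast]; exact h0 K
  have hconv : ∀ (K : ℕ) (z : ℂ), -(K : ℝ) < z.re → MellinConvergent (D K) z := fun K z hz =>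
    mellinConvergent_of_isBigO_rpow_exp hδ0 (hDc K) (hDtop K) (hDbot K) hz
  have hdiff : ∀ (K : ℕ) (z : ℂ), -(K : ℝ) < z.re → DifferentiableAt ℂ (mellin (D K)) z :=
    fun K z hz => mellin_differentiableAt_of_isBigO_rpow_exp hδ0 (hDc K) (hDtop K) (hDbot K) hz
  have hstep : ∀ (K : ℕ) (z : ℂ), -(K : ℝ) < z.re →
      mellin (D K) z = mellin (D (K + 1)) z + c K * Complex.Gamma (z + K) := by
    intro K z hz
    have hzK : 0 < (z + K).re := by simp; linarith
    have e1 : ∀ t ∈ Ioi (0 : ℝ), c K * ((t : ℂ) ^ (z + K - 1) * Complex.exp (-((1 : ℂ) * t))) =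
        (t : ℂ) ^ (z - 1) * (Complex.exp (-(t : ℂ)) * (c K * (t : ℂ) ^ K)) := by
      intro t ht
      have ht0 : (t : ℂ) ≠ 0 := by exact_mod_cast (ne_of_gt ht)
      rw [show z + K - 1 = (z - 1) + K by ring, Complex.cpow_add _ _ ht0, Complex.cpow_natCast,
        one_mul]
      ring
    have hint : IntegrableOn (fun t : ℝ =>
        c K * ((t : ℂ) ^ (z + K - 1) * Complex.exp (-((1 : ℂ) * t)))) (Ioi 0) :=
      (integrableOn_cpow_mul_exp_neg_mul_Ioi hzK (by simp)).const_mul (c K)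
    have hval := integral_cpow_mul_exp_neg_mul_Ioi_of_re_pos hzK (r := 1) (by simp)
    have hz' : -((K + 1 : ℕ) : ℝ) < z.re := by push_cast; linarith
    simp only [div_one, Complex.one_cpow, one_mul] at hval
    rw [← hval, ← integral_const_mul, mellin, mellin]
    have := integral_add (hconv (K + 1) z hz') hint
    simp only [one_mul] at this
    rw [← this]
    refine setIntegral_congr_fun measurableSet_Ioi fun t ht => ?_
    have e1' := e1 t ht
    rw [one_mul] at e1'
    simp only [smul_eq_mul, hD, Finset.sum_range_succ]
    rw [e1']
    ring
  choose R hRd hRv using exists_gamma_ratio M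
  -- The `K`-th candidate is valid on `Re s > M - K`. Candidates agree where both are valid, so they
  -- glue.
  set ZK : ℕ → ℂ → ℂ := fun K s => ∑ k ∈ Finset.range K, c k * R k s +
    (Complex.Gamma s)⁻¹ * mellin (D K) (s - M) with hZK
  have hZd : ∀ (K : ℕ) (s : ℂ), s ∈ U → (M : ℝ) - s.re < K → DifferentiableAt ℂ (ZK K) s := by
    intro K s hs hsK
    refine DifferentiableAt.add (DifferentiableAt.fun_sum fun k _ =>
      ((hRd k).differentiableAt (hUo.mem_nhds hs)).const_mul _) ?_
    refine (Complex.differentiable_one_div_Gamma s).mul ?_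
    have : DifferentiableAt ℂ (mellin (D K)) (s - M) := hdiff K _ (by simp; linarith)
    exact DifferentiableAt.comp (g := mellin (D K)) s this
      (by fun_prop : DifferentiableAt ℂ (fun s : ℂ => s - M) s)
  have hZstep : ∀ (K : ℕ) (s : ℂ), s ∈ U → (M : ℝ) - s.re < K → ZK (K + 1) s = ZK K s := by
    intro K s hs hsK
    have h1 := hstep K (s - M) (by simp; linarith)
    have h2 := hRv K s (by simp; linarith) hs
    simp only [hZK, Finset.sum_range_succ, h1, h2]
    ring
  have hZle : ∀ (K L : ℕ) (s : ℂ), s ∈ U → (M : ℝ) - s.re < K → K ≤ L → ZK L s = ZK K s := by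
    intro K L s hs hsK hKL
    induction L, hKL using Nat.le_induction with
    | base => rfl
    | succ L hL ih =>
      rw [hZstep L s hs (hsK.trans_le (by exact_mod_cast hL)), ih]
  have hZeq : ∀ (K L : ℕ) (s : ℂ), s ∈ U → (M : ℝ) - s.re < K → (M : ℝ) - s.re < L →
      ZK L s = ZK K s := by
    intro K L s hs hK hL
    rcases le_total K L with h | h
    · exact hZle K L s hs hK h
    · exact (hZle L K s hs hL h).symm
  -- A valid index at each `s`. It need not be locally constant, but near `s` the glued function
  -- agrees with the fixed candidate `ZK (κ s)`.
  set κ : ℂ → ℕ := fun s => ⌊(M : ℝ) - s.re⌋₊ + 1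
  have hκ : ∀ s, (M : ℝ) - s.re < κ s := fun s => by
    simpa [κ] using Nat.lt_floor_add_one ((M : ℝ) - s.re)
  refine ⟨fun s => ZK (κ s) s, fun s hs => ?_, fun s hs => ?_⟩
  · have hev : (fun s => ZK (κ s) s) =ᶠ[𝓝 s] ZK (κ s) := by
      have h1 : ∀ᶠ s' in 𝓝 s, (M : ℝ) - s'.re < κ s :=
        (continuous_const.sub Complex.continuous_re).continuousAt.eventually_lt
          continuousAt_const (hκ s)
      filter_upwards [h1, hUo.mem_nhds hs] with s' h1 h2
      exact hZeq _ _ s' h2 h1 (hκ s')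
    exact ((hZd _ s hs (hκ s)).congr_of_eventuallyEq hev).differentiableWithinAt
  · have hsU : s ∈ U := by
      intro k hk h
      have := (Finset.mem_Icc.1 hk).2
      rw [h, Complex.natCast_re] at hs
      exact absurd this (not_le.2 (by exact_mod_cast hs))
    have := hZeq 0 (κ s) s hsU (by simpa using hs) (hκ s)
    refine this.trans ?_
    simp [hZK, hD]

/-! ### The Barnes kernel at `0` and at infinity; continuation of the zeta function -/

/-- The entire function `t ↦ (1 - exp (-a t)) / t`, with value `a` at `0`. -/
def expSlope (a : ℝ) : ℝ → ℝ := dslope (fun t => 1 - Real.exp (-(a * t))) 0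

theorem expSlope_zero (a : ℝ) : expSlope a 0 = a := by
  have h1 : HasDerivAt (fun t : ℝ => 1 - Real.exp (-(a * t))) a 0 := by
    have := (((hasDerivAt_id (0 : ℝ)).const_mul a).neg.exp).const_sub 1
    simpa using! this
  rw [expSlope, dslope_same, h1.deriv]

theorem expSlope_of_ne (a : ℝ) {t : ℝ} (ht : t ≠ 0) :
    expSlope a t = (1 - Real.exp (-(a * t))) / t := by
  rw [expSlope, dslope_of_ne _ ht, slope_def_field]
  simp

theorem analyticAt_expSlope (a : ℝ) : AnalyticAt ℝ (expSlope a) 0 := by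
  have h1 : AnalyticAt ℝ (fun t : ℝ => 1 - Real.exp (-(a * t))) 0 := by fun_prop
  obtain ⟨p, hp⟩ := h1
  exact ⟨_, hp.has_fpower_series_dslope_fslope⟩

theorem barnesF_eq_prod_expSlope {M : ℕ} (a : Fin M → ℝ) {t : ℝ} (ht : t ≠ 0) :
    barnesF a t = ∏ j, (expSlope (a j) t)⁻¹ := by
  simp only [expSlope_of_ne _ ht, inv_div]
  simp only [div_eq_mul_inv, Finset.prod_mul_distrib, barnesF, Finset.prod_const, Finset.card_univ,
    Fintype.card_fin]

theorem analyticAt_prod_expSlope_inv {M : ℕ} {a : Fin M → ℝ} (ha : ∀ j, 0 < a j) :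
    AnalyticAt ℝ (fun t => ∏ j, (expSlope (a j) t)⁻¹) 0 :=
  Finset.analyticAt_fun_prod _ fun j _ =>
    (analyticAt_expSlope (a j)).inv (by rw [expSlope_zero]; exact (ha j).ne')

theorem one_sub_exp_neg_mul_pos {a t : ℝ} (ha : 0 < a) (ht : 0 < t) :
    0 < 1 - Real.exp (-(a * t)) := by
  have : Real.exp (-(a * t)) < 1 := by
    rw [← Real.exp_zero, Real.exp_lt_exp]; simpa using mul_pos ha ht
  linarith

theorem continuousOn_barnesF {M : ℕ} {a : Fin M → ℝ} (ha : ∀ j, 0 < a j) :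
    ContinuousOn (barnesF a) (Ioi 0) := by
  unfold barnesF
  refine ContinuousOn.mul (by fun_prop) (continuousOn_finsetProd _ fun j _ => ?_)
  exact ContinuousOn.inv₀ (by fun_prop) fun t ht => (one_sub_exp_neg_mul_pos (ha j) ht).ne'

theorem isBigO_prod_inv_one_sub_exp_atTop {M : ℕ} {a : Fin M → ℝ} (ha : ∀ j, 0 < a j) :
    (fun t : ℝ => ∏ j, (1 - Real.exp (-(a j * t)))⁻¹) =O[atTop] fun _ => (1 : ℝ) := by
  refine Tendsto.isBigO_one (F := ℝ) (c := ∏ _j : Fin M, (1 - 0 : ℝ)⁻¹) ?_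
  refine tendsto_finsetProd _ fun j _ => Tendsto.inv₀ (Tendsto.const_sub _ ?_) (by norm_num)
  exact Real.tendsto_exp_neg_atTop_nhds_zero.comp (tendsto_id.const_mul_atTop (ha j))

theorem isBigO_barnesF_atTop {M : ℕ} {a : Fin M → ℝ} (ha : ∀ j, 0 < a j) :
    barnesF a =O[atTop] fun t => t ^ M := by
  refine ((isBigO_refl (fun t : ℝ => t ^ M) atTop).mul
    (isBigO_prod_inv_one_sub_exp_atTop ha)).congr_right fun t => mul_one _

theorem isBigO_cexp_neg_mul_atTop {w : ℂ} {ε : ℝ} (hε : ε < w.re) {φ : ℝ → ℂ} {n : ℕ}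
    (hφ : φ =O[atTop] fun t : ℝ => t ^ n) :
    (fun t : ℝ => Complex.exp (-(w * t)) * φ t) =O[atTop] fun t : ℝ => Real.exp (-ε * t) := by
  have h1 : (fun t : ℝ => Complex.exp (-(w * t))) =O[atTop] fun t : ℝ => Real.exp (-w.re * t) :=
    IsBigO.of_bound 1 (Eventually.of_forall fun t => by simp [Complex.norm_exp])
  have h2 := hφ.trans (isLittleO_pow_exp_pos_mul_atTop n (sub_pos.2 hε)).isBigO
  refine (h1.mul h2).congr_right fun t => ?_
  rw [← Real.exp_add]
  ring_nf

/-- Analytic functions of a real variable have an asymptotic expansion at `0+`. -/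
theorem AnalyticAt.exists_isBigO_sub_sum_pow {g : ℝ → ℂ} (hg : AnalyticAt ℝ g 0) :
    ∃ c : ℕ → ℂ, ∀ K : ℕ, (fun t : ℝ => g t - ∑ k ∈ Finset.range K, c k * (t : ℂ) ^ k)
      =O[𝓝[>] 0] (· ^ K) := by
  obtain ⟨p, hp⟩ := hg
  refine ⟨p.coeff, fun K => ?_⟩
  have h1 := (hp.isBigO_sub_partialSum_pow K).mono (nhdsWithin_le_nhds (s := Ioi 0))
  simp only [zero_add, FormalMultilinearSeries.partialSum,
    FormalMultilinearSeries.apply_eq_pow_smul_coeff] at h1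
  refine (h1.trans (IsBigO.of_bound 1 (Eventually.of_forall fun t => by simp))).congr_left
    fun t => ?_
  congr 1
  refine Finset.sum_congr rfl fun k _ => ?_
  rw [← Complex.coe_smul, Complex.ofReal_pow, smul_eq_mul, mul_comm]

theorem exists_isBarnesZetaContinuation {M : ℕ} {a : Fin M → ℝ} (ha : ∀ j, 0 < a j) {w : ℂ}
    (hw : 0 < w.re) : ∃ Z, IsBarnesZetaContinuation a w Z := by
  -- The continuation uses models `e^{-t} t^k`, so the function to expand is `e^{t} · e^{-wt} f(t)`,
  -- which gives the exponent `1 - w`.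
  have hg : AnalyticAt ℝ (fun t : ℝ => Complex.exp ((1 - w) * t) *
      ((∏ j, (expSlope (a j) t)⁻¹ : ℝ) : ℂ)) 0 := by
    have h1 : AnalyticAt ℝ (fun t : ℝ => (t : ℂ)) 0 := Complex.ofRealCLM.analyticAt 0
    have h2 : AnalyticAt ℝ (fun t : ℝ => ((∏ j, (expSlope (a j) t)⁻¹ : ℝ) : ℂ)) 0 :=
      (Complex.ofRealCLM.analyticAt _).comp (analyticAt_prod_expSlope_inv ha)
    have h3 : AnalyticAt ℝ (fun t : ℝ => Complex.exp ((1 - w) * t)) 0 :=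
      ((analyticAt_cexp (z := (1 - w) * ((0 : ℝ) : ℂ))).restrictScalars (𝕜 := ℝ)).comp
        (g := Complex.exp) (f := fun t : ℝ => (1 - w) * (t : ℂ)) (analyticAt_const.mul h1)
    exact h3.mul h2
  obtain ⟨c, hc⟩ := hg.exists_isBigO_sub_sum_pow
  have hexp : ∀ K : ℕ, (fun t : ℝ => Complex.exp (-(w * t)) * (barnesF a t : ℂ) -
      Complex.exp (-(t : ℂ)) * ∑ k ∈ Finset.range K, c k * (t : ℂ) ^ k) =O[𝓝[>] 0] (· ^ K) := by
    intro K
    have h1 : (fun t : ℝ => Complex.exp (-(t : ℂ))) =O[𝓝[>] 0] fun _ => (1 : ℝ) :=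
      ((by fun_prop : Continuous fun t : ℝ => Complex.exp (-(t : ℂ))).tendsto 0).isBigO_one ℝ
        |>.mono nhdsWithin_le_nhds
    refine (h1.mul (hc K)).congr' ?_ (Eventually.of_forall fun t => by simp)
    filter_upwards [self_mem_nhdsWithin] with t ht
    rw [barnesF_eq_prod_expSlope a (ne_of_gt ht), mul_sub, ← mul_assoc, ← Complex.exp_add]
    ring_nf
  obtain ⟨Z, hZd, hZ⟩ := exists_continuation_inv_Gamma_mul_mellin M (half_pos hw)
    (ψ := fun t => Complex.exp (-(w * t)) * (barnesF a t : ℂ))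
    ((by fun_prop : Continuous fun t : ℝ => Complex.exp (-(w * t))).continuousOn.mul
      (Complex.continuous_ofReal.comp_continuousOn (continuousOn_barnesF ha)))
    (isBigO_cexp_neg_mul_atTop (half_lt_self hw)
      (((isBigO_barnesF_atTop ha).norm_left.congr_left
        fun t => (Complex.norm_real (barnesF a t)).symm).of_norm_left))
    c hexp
  refine ⟨Z, hZd, fun s hs => ?_⟩
  rw [hZ s hs, barnesZetaIntegral, mellin]
  congr 1
  refine setIntegral_congr_fun measurableSet_Ioi fun t ht => ?_
  have ht0 : (t : ℂ) ≠ 0 := by exact_mod_cast (ne_of_gt ht)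
  simp only [smul_eq_mul]
  rw [show s - M - 1 = (s - 1) - (M : ℂ) by ring, Complex.cpow_sub _ _ ht0,
    Complex.cpow_natCast]
  push_cast
  ring

theorem isBarnesZetaContinuation_barnesZeta {M : ℕ} {a : Fin M → ℝ} (ha : ∀ j, 0 < a j) {w : ℂ}
    (hw : 0 < w.re) : IsBarnesZetaContinuation a w (barnesZeta a w) :=
  Classical.epsilon_spec (exists_isBarnesZetaContinuation ha hw)

/-! ### Comparing derivatives at `0`; the difference equation -/

/-- Two functions, holomorphic on a convex region that contains `0` and avoids the positive
integers, which agree far to the right have the same derivative at `0`. -/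
theorem deriv_zero_eq_of_eq_of_lt_re {F G : ℂ → ℂ} {R : ℝ}
    (hF : DifferentiableOn ℂ F {s : ℂ | -1 < s.re ∧ s.re - 1 / 2 < s.im})
    (hG : DifferentiableOn ℂ G {s : ℂ | -1 < s.re ∧ s.re - 1 / 2 < s.im})
    (h : ∀ s : ℂ, R < s.re → F s = G s) : deriv F 0 = deriv G 0 := by
  -- On the real axis `V` contains only points below `1/2`, so it misses the poles, yet it reaches
  -- arbitrarily large real parts along `r + ir`.
  set V : Set ℂ := {s : ℂ | -1 < s.re ∧ s.re - 1 / 2 < s.im}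
  have hVo : IsOpen V := (isOpen_lt continuous_const Complex.continuous_re).inter
    (isOpen_lt (Complex.continuous_re.sub continuous_const) Complex.continuous_im)
  have hVc : Convex ℝ V := by
    intro x hx y hy a b ha hb hab
    obtain rfl : b = 1 - a := by linarith
    have hx1 : -1 < x.re := hx.1
    have hx2 : x.re - 1 / 2 < x.im := hx.2
    have hy1 : -1 < y.re := hy.1
    have hy2 : y.re - 1 / 2 < y.im := hy.2
    rcases ha.eq_or_lt with rfl | ha
    · simpa using hy
    · constructor
      · simp only [Complex.add_re, Complex.real_smul, Complex.re_ofReal_mul]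
        nlinarith
      · simp only [Complex.add_re, Complex.add_im, Complex.real_smul, Complex.re_ofReal_mul,
          Complex.im_ofReal_mul]
        nlinarith
  set r : ℝ := max R 0 + 1
  have hr : R < r := by have := le_max_left R 0; simp only [r]; linarith
  have hr0 : 0 < r := by have := le_max_right R 0; simp only [r]; linarith
  have hz : (⟨r, r⟩ : ℂ) ∈ V := ⟨by simp only; linarith, by simp only; linarith⟩
  have hev : F =ᶠ[𝓝 (⟨r, r⟩ : ℂ)] G := by
    filter_upwards [(isOpen_lt continuous_const Complex.continuous_re).mem_nhds
      (show R < (⟨r, r⟩ : ℂ).re from hr)] with s hs using h s hs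
  have heq := (hF.analyticOnNhd hVo).eqOn_of_preconnected_of_eventuallyEq (hG.analyticOnNhd hVo)
    hVc.isPreconnected hz hev
  have h0 : (0 : ℂ) ∈ V := ⟨by simp, by norm_num⟩
  exact (heq.eventuallyEq_of_mem (hVo.mem_nhds h0)).deriv_eq

theorem ne_natCast_of_re_sub_half_lt_im {s : ℂ} (hs : s.re - 1 / 2 < s.im) (M : ℕ) :
    ∀ k ∈ Finset.Icc 1 M, s ≠ (k : ℂ) := by
  rintro k hk rfl
  have : (1 : ℝ) ≤ k := by exact_mod_cast (Finset.mem_Icc.1 hk).1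
  simp only [Complex.natCast_re, Complex.natCast_im] at hs
  linarith

theorem IsBarnesZetaContinuation.differentiableOn_region {M : ℕ} {a : Fin M → ℝ} {w : ℂ}
    {Z : ℂ → ℂ} (h : IsBarnesZetaContinuation a w Z) :
    DifferentiableOn ℂ Z {s : ℂ | -1 < s.re ∧ s.re - 1 / 2 < s.im} :=
  h.1.mono fun _ hs => ne_natCast_of_re_sub_half_lt_im hs.2 M

theorem IsBarnesZetaContinuation.differentiableAt_zero {M : ℕ} {a : Fin M → ℝ} {w : ℂ}
    {Z : ℂ → ℂ} (h : IsBarnesZetaContinuation a w Z) : DifferentiableAt ℂ Z 0 :=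
  h.1.differentiableAt ((isOpen_compl_naturals_Icc M).mem_nhds
    (ne_natCast_of_re_sub_half_lt_im (by norm_num) M))

theorem isBigO_prod_expSlope_inv_zero {M : ℕ} {a : Fin M → ℝ} (ha : ∀ j, 0 < a j) :
    (fun t => ∏ j, (expSlope (a j) t)⁻¹) =O[𝓝[>] 0] fun _ => (1 : ℝ) :=
  ((analyticAt_prod_expSlope_inv ha).continuousAt.tendsto.isBigO_one ℝ).mono nhdsWithin_le_nhds

theorem continuousOn_prod_inv_one_sub_exp {M : ℕ} {a : Fin M → ℝ} (ha : ∀ j, 0 < a j) :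
    ContinuousOn (fun t : ℝ => ∏ j, (1 - Real.exp (-(a j * t)))⁻¹) (Ioi 0) :=
  continuousOn_finsetProd _ fun j _ =>
    ContinuousOn.inv₀ (by fun_prop) fun _ ht => (one_sub_exp_neg_mul_pos (ha j) ht).ne'

theorem isBigO_ofReal_comp {l : Filter ℝ} {f g : ℝ → ℝ} (h : f =O[l] g) :
    (fun t => (f t : ℂ)) =O[l] g :=
  (h.norm_left.congr_left fun t => (Complex.norm_real (f t)).symm).of_norm_left

theorem mellinConvergent_barnes {M : ℕ} {a : Fin M → ℝ} (ha : ∀ j, 0 < a j) {w s : ℂ}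
    (hw : 0 < w.re) (hs : (M : ℝ) < s.re) :
    MellinConvergent (fun t : ℝ => Complex.exp (-(w * t)) *
      ((∏ j, (1 - Real.exp (-(a j * t)))⁻¹ : ℝ) : ℂ)) s := by
  refine mellinConvergent_of_isBigO_rpow_exp (half_pos hw) (b := M) ?_ ?_ ?_ hs
  · exact ((by fun_prop : Continuous fun t : ℝ => Complex.exp (-(w * t))).continuousOn.mul
      (Complex.continuous_ofReal.comp_continuousOn
        (continuousOn_prod_inv_one_sub_exp ha))).locallyIntegrableOn measurableSet_Ioi
  · exact isBigO_cexp_neg_mul_atTop (n := 0) (half_lt_self hw)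
      (by simpa using isBigO_ofReal_comp (isBigO_prod_inv_one_sub_exp_atTop ha))
  · have h1 : (fun t : ℝ => Complex.exp (-(w * t))) =O[𝓝[>] 0] fun _ => (1 : ℝ) :=
      ((by fun_prop : Continuous fun t : ℝ => Complex.exp (-(w * t))).tendsto 0).isBigO_one ℝ
        |>.mono nhdsWithin_le_nhds
    have h2 : (fun t : ℝ => ∏ j, (1 - Real.exp (-(a j * t)))⁻¹) =O[𝓝[>] 0]
        fun t : ℝ => t ^ (-(M : ℝ)) := by
      refine ((isBigO_prod_expSlope_inv_zero ha).mul
        (isBigO_refl (fun t : ℝ => t ^ (-(M : ℝ))) _)).congr' ?_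
        (Eventually.of_forall fun t => one_mul _)
      filter_upwards [self_mem_nhdsWithin] with t ht
      have ht0 : t ≠ 0 := ne_of_gt ht
      rw [← barnesF_eq_prod_expSlope a ht0, barnesF, Real.rpow_neg (le_of_lt ht),
        Real.rpow_natCast, mul_right_comm, mul_inv_cancel₀ (pow_ne_zero _ ht0), one_mul]
    simpa using h1.mul (isBigO_ofReal_comp h2)

theorem barnesZetaIntegral_eq_mellin {M : ℕ} (a : Fin M → ℝ) (w s : ℂ) :
    barnesZetaIntegral a w s = (Complex.Gamma s)⁻¹ *
      mellin (fun t : ℝ => Complex.exp (-(w * t)) *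
        ((∏ j, (1 - Real.exp (-(a j * t)))⁻¹ : ℝ) : ℂ)) s := by
  rw [barnesZetaIntegral, mellin]
  congr 1
  refine setIntegral_congr_fun measurableSet_Ioi fun t ht => ?_
  have ht0 : t ^ M ≠ 0 := pow_ne_zero _ (ne_of_gt ht)
  simp only [barnesF, smul_eq_mul]
  rw [mul_div_cancel_left₀ _ ht0, mul_assoc]

/-- The difference equation of the Barnes log-gamma functions. -/
theorem barnesLogGamma_sub_add {m : ℕ} {a : Fin (m + 1) → ℝ} (ha : ∀ j, 0 < a j)
    (i : Fin (m + 1)) {w : ℂ} (hw : 0 < w.re) :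
    barnesLogGamma a w - barnesLogGamma a (w + a i) =
      barnesLogGamma (fun j : Fin m => a (i.succAbove j)) w := by
  have hw' : 0 < (w + a i).re := by simpa using add_pos hw (ha i)
  have h1 := isBarnesZetaContinuation_barnesZeta ha hw
  have h2 := isBarnesZetaContinuation_barnesZeta ha hw'
  have ha' : ∀ j : Fin m, 0 < a (i.succAbove j) := fun j => ha _
  have h3 := isBarnesZetaContinuation_barnesZeta ha' hw
  -- For `Re s > m + 1` all three integrals converge, and the factor `1 - e^{-a_i t}` cancels the
  -- `i`-th factor of the kernel.
  have key := deriv_zero_eq_of_eq_of_lt_re (R := (m + 1 : ℕ))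
    (h1.differentiableOn_region.sub h2.differentiableOn_region) h3.differentiableOn_region ?_
  · rw [deriv_sub h1.differentiableAt_zero h2.differentiableAt_zero] at key
    exact key
  · intro s hs
    have hs' : (m : ℝ) < s.re := by push_cast at hs; linarith
    rw [Pi.sub_apply, h1.2 s hs, h2.2 s hs, h3.2 s hs', barnesZetaIntegral_eq_mellin,
      barnesZetaIntegral_eq_mellin, barnesZetaIntegral_eq_mellin, ← mul_sub]
    congr 1
    rw [mellin, mellin, mellin, ← integral_sub (mellinConvergent_barnes ha hw hs)
      (mellinConvergent_barnes ha hw' hs)]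
    refine setIntegral_congr_fun measurableSet_Ioi fun t ht => ?_
    have hne : 1 - Complex.exp (-((a i : ℂ) * t)) ≠ 0 := by
      have := (one_sub_exp_neg_mul_pos (ha i) ht).ne'
      exact_mod_cast this
    have hexp : Complex.exp (-((w + a i) * t)) =
        Complex.exp (-(w * t)) * Complex.exp (-((a i : ℂ) * t)) := by
      rw [← Complex.exp_add]; ring_nf
    simp only [smul_eq_mul]
    rw [Fin.prod_univ_succAbove _ i, hexp]
    push_cast
    generalize ∏ j : Fin m, (1 - Complex.exp (-((a (i.succAbove j) : ℂ) * t)))⁻¹ = P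
    generalize Complex.exp (-((a i : ℂ) * t)) = x at hne ⊢
    linear_combination
      (t : ℂ) ^ (s - 1) * Complex.exp (-(w * t)) * P * mul_inv_cancel₀ hne

/-- With an empty kernel the Gamma integral gives `ζ_0(s, w) = w^{-s}`. This case later yields
Frullani's integral. -/
theorem barnesLogGamma_fin_zero (a : Fin 0 → ℝ) {w : ℂ} (hw : 0 < w.re) :
    barnesLogGamma a w = -Complex.log w := by
  have h1 := isBarnesZetaContinuation_barnesZeta (a := a) (fun j => j.elim0) hw
  have hw0 : w ≠ 0 := by rintro rfl; simp at hw
  have hd : ∀ s : ℂ, HasDerivAt (fun s : ℂ => Complex.exp (-Complex.log w * s))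
      (Complex.exp (-Complex.log w * s) * (-Complex.log w)) s := fun s => by
    simpa using ((hasDerivAt_id s).const_mul (-Complex.log w)).cexp
  have key := deriv_zero_eq_of_eq_of_lt_re (R := (0 : ℕ)) h1.differentiableOn_region
    (G := fun s => Complex.exp (-Complex.log w * s))
    (fun s _ => (hd s).differentiableAt.differentiableWithinAt) ?_
  · rw [barnesLogGamma, key, (hd 0).deriv]
    simp
  · intro s hs
    have hs0 : 0 < s.re := by simpa using hs
    rw [h1.2 s hs, barnesZetaIntegral_eq_mellin, mellin]
    have := integral_cpow_mul_exp_neg_mul_Ioi_of_re_pos hs0 hw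
    simp only [Finset.univ_eq_empty, Finset.prod_empty, Complex.ofReal_one, mul_one, smul_eq_mul]
    rw [this, mul_comm, mul_assoc, mul_inv_cancel₀ (Complex.Gamma_ne_zero_of_re_pos hs0), mul_one,
      Complex.cpow_def_of_ne_zero (one_div_ne_zero hw0), one_div, Complex.log_inv]
    intro h
    rw [Complex.arg_eq_pi_iff] at h
    linarith [h.1]

/-! ### The Lévy density and the Malmstén-type formula -/

/-- `e ^ (-b₀ t) ∏ (1 - e ^ (-b_k t)) / ∏ (1 - e ^ (-a_j t))`, which is `t` times the Lévy density
of `-log β_{M,N}(a, b)`. -/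
def barnesLevy {M N : ℕ} (a : Fin M → ℝ) (b : Fin (N + 1) → ℝ) (t : ℝ) : ℝ :=
  Real.exp (-(b 0 * t)) * (∏ k : Fin N, (1 - Real.exp (-(b k.succ * t)))) *
    ∏ j, (1 - Real.exp (-(a j * t)))⁻¹

section Levy

variable {M N : ℕ} {a : Fin M → ℝ} {b : Fin (N + 1) → ℝ}

theorem continuousOn_barnesLevy (ha : ∀ j, 0 < a j) :
    ContinuousOn (barnesLevy a b) (Ioi 0) := by
  unfold barnesLevy
  exact (by fun_prop : Continuous fun t : ℝ => Real.exp (-(b 0 * t)) *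
    (∏ k : Fin N, (1 - Real.exp (-(b k.succ * t))))).continuousOn.mul
      (continuousOn_prod_inv_one_sub_exp ha)

theorem analyticAt_barnesLevy_extension (ha : ∀ j, 0 < a j) :
    AnalyticAt ℝ (fun t : ℝ => Real.exp (-(b 0 * t)) * t ^ (N - M) *
      (∏ k : Fin N, expSlope (b k.succ) t) * ∏ j, (expSlope (a j) t)⁻¹) 0 := by
  have h1 : AnalyticAt ℝ (fun t : ℝ => Real.exp (-(b 0 * t)) * t ^ (N - M)) 0 := by fun_prop
  exact (h1.mul (Finset.analyticAt_fun_prod _ fun k _ => analyticAt_expSlope _)).mul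
    (analyticAt_prod_expSlope_inv ha)

/-- Taking one factor `t` out of each `1 - e^{-ct}` leaves `t^{N-M}`; `M ≤ N` makes this a genuine
power, so the singularity at `0` is removable. -/
theorem barnesLevy_eq_extension (hMN : M ≤ N) {t : ℝ} (ht : t ≠ 0) :
    barnesLevy a b t = Real.exp (-(b 0 * t)) * t ^ (N - M) *
      (∏ k : Fin N, expSlope (b k.succ) t) * ∏ j, (expSlope (a j) t)⁻¹ := by
  rw [← barnesF_eq_prod_expSlope a ht, barnesF, barnesLevy]
  simp only [expSlope_of_ne _ ht, Finset.prod_div_distrib, Finset.prod_const, Finset.card_univ,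
    Fintype.card_fin]
  have h0 : t ^ N = t ^ (N - M) * t ^ M := by rw [← pow_add, Nat.sub_add_cancel hMN]
  have h1 : t ^ (N - M) ≠ 0 := pow_ne_zero _ ht
  have h2 : t ^ M ≠ 0 := pow_ne_zero _ ht
  rw [h0]
  generalize ∏ j, (1 - Real.exp (-(a j * t)))⁻¹ = P
  field_simp

theorem barnesLevy_isBigO_zero (ha : ∀ j, 0 < a j) (hMN : M ≤ N) :
    barnesLevy a b =O[𝓝[>] 0] fun _ => (1 : ℝ) := by
  refine (((analyticAt_barnesLevy_extension (b := b) ha).continuousAt.tendsto.isBigO_one ℝ).mono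
    nhdsWithin_le_nhds).congr' ?_ EventuallyEq.rfl
  filter_upwards [self_mem_nhdsWithin] with t ht
  exact (barnesLevy_eq_extension hMN (ne_of_gt ht)).symm

theorem isBigO_cexp_mul_barnesLevy_atTop (ha : ∀ j, 0 < a j) (hb : ∀ k, 0 < b k) {q : ℂ} {ε : ℝ}
    (hε : ε < b 0 + q.re) :
    (fun t : ℝ => Complex.exp (-(q * t)) * (barnesLevy a b t : ℂ)) =O[atTop]
      fun t => Real.exp (-ε * t) := by
  have h1 : (fun t : ℝ => ∏ k : Fin N, (1 - Real.exp (-(b k.succ * t)))) =O[atTop]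
      fun _ => (1 : ℝ) := by
    refine Tendsto.isBigO_one (F := ℝ) (c := ∏ _k : Fin N, (1 - 0 : ℝ)) ?_
    refine tendsto_finsetProd _ fun j _ => Tendsto.const_sub _ ?_
    exact Real.tendsto_exp_neg_atTop_nhds_zero.comp (tendsto_id.const_mul_atTop (hb _))
  have h2 := isBigO_ofReal_comp (h1.mul (isBigO_prod_inv_one_sub_exp_atTop ha))
  refine (isBigO_cexp_neg_mul_atTop (w := b 0 + q) (n := 0) (by simpa using hε)
    (h2.congr_right fun t => by simp)).congr_left fun t => ?_
  have : Complex.exp (-((b 0 + q) * t)) =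
      Complex.exp (-(q * t)) * Complex.exp (-((b 0 : ℂ) * t)) := by
    rw [← Complex.exp_add]; ring_nf
  rw [this, barnesLevy]
  push_cast
  ring

/-- Inclusion–exclusion: the signed sum over subsets is the expansion of `∏ (1 - e^{-b_k t})`. -/
theorem sum_neg_one_pow_card_mul_exp (b : Fin (N + 1) → ℝ) (q : ℂ) (t : ℝ) :
    ∑ K : Finset (Fin N), (-1 : ℂ) ^ K.card *
      Complex.exp (-((q + (b 0 : ℂ) + ∑ k ∈ K, (b k.succ : ℂ)) * t)) =
    Complex.exp (-(q * t)) * (Complex.exp (-((b 0 : ℂ) * t)) *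
      ∏ k : Fin N, (1 - Complex.exp (-((b k.succ : ℂ) * t)))) := by
  have h1 : ∏ k : Fin N, (1 - Complex.exp (-((b k.succ : ℂ) * t))) =
      ∑ K : Finset (Fin N), ∏ k ∈ K, -Complex.exp (-((b k.succ : ℂ) * t)) := by
    simp only [sub_eq_add_neg]
    rw [Finset.prod_one_add, Finset.powerset_univ]
  rw [h1, Finset.mul_sum, Finset.mul_sum]
  refine Finset.sum_congr rfl fun K _ => ?_
  rw [Finset.prod_neg, ← Complex.exp_sum, mul_left_comm, mul_left_comm (Complex.exp (-(q * t))),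
    ← Complex.exp_add, mul_left_comm, ← Complex.exp_add]
  congr 2
  rw [Finset.sum_neg_distrib, ← Finset.sum_mul]
  ring

/-- Subtracting the value at `q = 0` gains a factor `t` at the origin, which moves the Mellin strip
to `Re s > -1` and so includes `s = 0`. -/
theorem barnesLevy_mellin_bounds (ha : ∀ j, 0 < a j) (hb : ∀ k, 0 < b k) (hMN : M ≤ N) {q : ℂ}
    (hq : -b 0 < q.re) : ∃ ε > 0,
    LocallyIntegrableOn (fun t : ℝ => (Complex.exp (-(q * t)) - 1) * (barnesLevy a b t : ℂ))
      (Ioi 0) ∧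
    (fun t : ℝ => (Complex.exp (-(q * t)) - 1) * (barnesLevy a b t : ℂ)) =O[atTop]
      (fun t => Real.exp (-ε * t)) ∧
    (fun t : ℝ => (Complex.exp (-(q * t)) - 1) * (barnesLevy a b t : ℂ)) =O[𝓝[>] 0]
      (fun t : ℝ => t ^ (-(-1 : ℝ))) := by
  have hε : 0 < min (b 0) (b 0 + q.re) := lt_min (hb 0) (by linarith)
  refine ⟨min (b 0) (b 0 + q.re) / 2, half_pos hε, ?_, ?_, ?_⟩
  · exact ((by fun_prop : Continuous fun t : ℝ => Complex.exp (-(q * t)) - 1).continuousOn.mul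
      (Complex.continuous_ofReal.comp_continuousOn
        (continuousOn_barnesLevy ha))).locallyIntegrableOn measurableSet_Ioi
  · have h1 := isBigO_cexp_mul_barnesLevy_atTop (q := q) ha hb
      ((half_lt_self hε).trans_le (min_le_right _ _))
    have h2 := isBigO_cexp_mul_barnesLevy_atTop (q := 0) ha hb
      ((half_lt_self hε).trans_le ((min_le_left _ _).trans (by simp)))
    refine (h1.sub h2).congr_left fun t => ?_
    simp [sub_mul]
  · have h1 : (fun t : ℝ => Complex.exp (-(q * t)) - 1) =O[𝓝[>] 0] fun t : ℝ => t := by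
      have hd : DifferentiableAt ℝ (fun t : ℝ => Complex.exp (-(q * t))) 0 := by fun_prop
      simpa using hd.isBigO_sub.mono (nhdsWithin_le_nhds (s := Ioi 0))
    refine (h1.mul (isBigO_ofReal_comp (barnesLevy_isBigO_zero ha hMN))).congr_right fun t => ?_
    simp

/-- Malmstén-type formula for `𝒮_N L_M`. -/
theorem integral_barnesLevy (ha : ∀ j, 0 < a j) (hb : ∀ k, 0 < b k) (hMN : M ≤ N) {q : ℂ}
    (hq : -b 0 < q.re) :
    IntegrableOn (fun t : ℝ => (Complex.exp (-(q * t)) - 1) * ((barnesLevy a b t / t : ℝ) : ℂ))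
      (Ioi 0) ∧
    barnesS b (barnesLogGamma a) q - barnesS b (barnesLogGamma a) 0 =
      ∫ t in Ioi (0 : ℝ), (Complex.exp (-(q * t)) - 1) * ((barnesLevy a b t / t : ℝ) : ℂ) := by
  set φ : ℝ → ℂ := fun t : ℝ => (Complex.exp (-(q * t)) - 1) * (barnesLevy a b t : ℂ) with hφ
  obtain ⟨ε, hε, h1, h2, h3⟩ := barnesLevy_mellin_bounds ha hb hMN hq
  have hconv : ∀ s : ℂ, -1 < s.re → MellinConvergent φ s := fun s hs =>
    mellinConvergent_of_isBigO_rpow_exp hε h1 h2 h3 hs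
  have hdiff : ∀ s : ℂ, -1 < s.re → DifferentiableAt ℂ (mellin φ) s := fun s hs =>
    mellin_differentiableAt_of_isBigO_rpow_exp hε h1 h2 h3 hs
  have hcongr : EqOn (fun t : ℝ => (t : ℂ) ^ ((0 : ℂ) - 1) • φ t)
      (fun t : ℝ => (Complex.exp (-(q * t)) - 1) * ((barnesLevy a b t / t : ℝ) : ℂ)) (Ioi 0) := by
    intro t _
    simp only [zero_sub, Complex.cpow_neg_one, smul_eq_mul, hφ]
    push_cast
    ring
  refine ⟨(hconv 0 (by simp)).congr_fun hcongr measurableSet_Ioi, ?_⟩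
  rw [← setIntegral_congr_fun measurableSet_Ioi hcongr]
  change _ = mellin φ 0
  have hre : ∀ (p : ℂ) (K : Finset (Fin N)), -b 0 < p.re →
      0 < (p + (b 0 : ℂ) + ∑ k ∈ K, (b k.succ : ℂ)).re := by
    intro p K hp
    have : 0 ≤ ∑ k ∈ K, b k.succ := Finset.sum_nonneg fun k _ => (hb _).le
    simp only [Complex.add_re, Complex.ofReal_re, Complex.re_sum]
    linarith
  have h0 : -b 0 < (0 : ℂ).re := by simpa using hb 0
  have hZ : ∀ (p : ℂ) (K : Finset (Fin N)), -b 0 < p.re →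
      IsBarnesZetaContinuation a (p + (b 0 : ℂ) + ∑ k ∈ K, (b k.succ : ℂ))
        (barnesZeta a (p + (b 0 : ℂ) + ∑ k ∈ K, (b k.succ : ℂ))) := fun p K hp =>
    isBarnesZetaContinuation_barnesZeta ha (hre p K hp)
  set S : ℂ → ℂ → ℂ := fun p s => barnesS b (fun w => barnesZeta a w s) p with hS
  have hSd : ∀ p : ℂ, -b 0 < p.re → HasDerivAt (S p) (barnesS b (barnesLogGamma a) p) 0 := by
    intro p hp
    exact HasDerivAt.fun_sum fun K _ =>
      ((hZ p K hp).differentiableAt_zero.hasDerivAt).const_mul _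
  have hSo : ∀ p : ℂ, -b 0 < p.re →
      DifferentiableOn ℂ (S p) {s : ℂ | -1 < s.re ∧ s.re - 1 / 2 < s.im} := by
    intro p hp
    exact DifferentiableOn.fun_sum fun K _ =>
      (hZ p K hp).differentiableOn_region.const_mul _
  have hSint : ∀ p : ℂ, -b 0 < p.re → ∀ s : ℂ, (M : ℝ) < s.re →
      IntegrableOn (fun t : ℝ => (t : ℂ) ^ (s - 1) *
        (Complex.exp (-(p * t)) * (barnesLevy a b t : ℂ))) (Ioi 0) ∧
      S p s = (Complex.Gamma s)⁻¹ * ∫ t in Ioi (0 : ℝ), (t : ℂ) ^ (s - 1) *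
        (Complex.exp (-(p * t)) * (barnesLevy a b t : ℂ)) := by
    intro p hp s hs
    have hi : ∀ K ∈ (Finset.univ : Finset (Finset (Fin N))), IntegrableOn (fun t : ℝ =>
        (-1 : ℂ) ^ K.card * ((t : ℂ) ^ (s - 1) •
        (Complex.exp (-((p + (b 0 : ℂ) + ∑ k ∈ K, (b k.succ : ℂ)) * t)) *
          ((∏ j, (1 - Real.exp (-(a j * t)))⁻¹ : ℝ) : ℂ)))) (Ioi 0) := fun K _ =>
      (mellinConvergent_barnes ha (hre p K hp) hs).const_mul _
    have hsum : ∀ t : ℝ, ∑ K : Finset (Fin N), (-1 : ℂ) ^ K.card * ((t : ℂ) ^ (s - 1) •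
        (Complex.exp (-((p + (b 0 : ℂ) + ∑ k ∈ K, (b k.succ : ℂ)) * t)) *
          ((∏ j, (1 - Real.exp (-(a j * t)))⁻¹ : ℝ) : ℂ))) =
        (t : ℂ) ^ (s - 1) * (Complex.exp (-(p * t)) * (barnesLevy a b t : ℂ)) := by
      intro t
      have e1 := sum_neg_one_pow_card_mul_exp b p t
      rw [barnesLevy]
      push_cast
      rw [← mul_assoc (Complex.exp (-(p * t))), ← e1, Finset.sum_mul, Finset.mul_sum]
      refine Finset.sum_congr rfl fun K _ => ?_
      simp only [smul_eq_mul]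
      ring
    refine ⟨(integrable_finsetSum _ hi).congr (Eventually.of_forall hsum), ?_⟩
    simp_rw [← hsum]
    rw [integral_finsetSum _ hi, Finset.mul_sum]
    refine Finset.sum_congr rfl fun K _ => ?_
    beta_reduce
    rw [(hZ p K hp).2 s hs, barnesZetaIntegral_eq_mellin, integral_const_mul, mellin]
    ring
  -- The zero of `1/Γ` at `0` kills the term with the derivative of the Mellin transform.
  have hGd : HasDerivAt (fun s : ℂ => (Complex.Gamma s)⁻¹ * mellin φ s) (mellin φ 0) 0 := by
    have := hasDerivAt_inv_Gamma_zero.mul (hdiff 0 (by simp)).hasDerivAt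
    simpa using! this
  have key := deriv_zero_eq_of_eq_of_lt_re (R := M) ((hSo q hq).sub (hSo 0 h0))
    (G := fun s : ℂ => (Complex.Gamma s)⁻¹ * mellin φ s)
    (fun s hs => ((Complex.differentiable_one_div_Gamma s).mul
      (hdiff s hs.1)).differentiableWithinAt) ?_
  · rwa [((hSd q hq).sub (hSd 0 h0)).deriv, hGd.deriv] at key
  · intro s hs
    obtain ⟨i1, e1⟩ := hSint q hq s hs
    obtain ⟨i2, e2⟩ := hSint 0 h0 s hs
    rw [Pi.sub_apply, e1, e2, ← mul_sub, ← integral_sub i1 i2, mellin]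
    congr 1
    refine setIntegral_congr_fun measurableSet_Ioi fun t _ => ?_
    simp only [hφ, smul_eq_mul, zero_mul, neg_zero, Complex.exp_zero]
    ring

end Levy

/-! ### Convolutions and compound Poisson laws -/

theorem ae_nonneg_conv {μ ν : Measure ℝ} [SFinite ν] (hμ : ∀ᵐ x ∂μ, 0 ≤ x)
    (hν : ∀ᵐ x ∂ν, 0 ≤ x) : ∀ᵐ x ∂(μ.conv ν), 0 ≤ x := by
  have hm : Measurable ((Iio (0 : ℝ)).indicator fun _ => (1 : ENNReal)) :=
    measurable_const.indicator measurableSet_Iio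
  have h1 : μ.conv ν (Iio 0) = 0 := by
    rw [← lintegral_indicator_one measurableSet_Iio]
    change ∫⁻ x, (Iio (0 : ℝ)).indicator (fun _ => (1 : ENNReal)) x ∂(μ.conv ν) = 0
    rw [Measure.lintegral_conv hm]
    refine (lintegral_congr_ae ?_).trans lintegral_zero
    filter_upwards [hμ] with x hx
    refine (lintegral_congr_ae ?_).trans lintegral_zero
    filter_upwards [hν] with y hy
    simp [add_nonneg hx hy]
  rw [ae_iff]
  simpa [Iio] using h1

theorem cexp_neg_mul_add (q : ℂ) (x y : ℝ) : Complex.exp (-(q * ((x + y : ℝ) : ℂ))) =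
    Complex.exp (-(q * x)) * Complex.exp (-(q * y)) := by
  rw [← Complex.exp_add]; push_cast; ring_nf

theorem lintegral_enorm_cexp_conv (μ ν : Measure ℝ) [SFinite ν] (q : ℂ) :
    ∫⁻ x : ℝ, ‖Complex.exp (-(q * x))‖ₑ ∂(μ.conv ν) =
      (∫⁻ x : ℝ, ‖Complex.exp (-(q * x))‖ₑ ∂μ) * ∫⁻ x : ℝ, ‖Complex.exp (-(q * x))‖ₑ ∂ν := by
  have hm : Measurable fun x : ℝ => ‖Complex.exp (-(q * x))‖ₑ :=
    (by fun_prop : Continuous fun x : ℝ => Complex.exp (-(q * x))).measurable.enorm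
  rw [Measure.lintegral_conv hm]
  simp only [cexp_neg_mul_add, enorm_mul]
  simp_rw [lintegral_const_mul _ hm]
  rw [lintegral_mul_const _ hm]

theorem integrable_cexp_iff (μ : Measure ℝ) (q : ℂ) :
    Integrable (fun x : ℝ => Complex.exp (-(q * x))) μ ↔
      ∫⁻ x : ℝ, ‖Complex.exp (-(q * x))‖ₑ ∂μ < ⊤ :=
  ⟨fun h => h.2, fun h =>
    ⟨(by fun_prop : Continuous fun x : ℝ => Complex.exp (-(q * x))).aestronglyMeasurable, h⟩⟩

theorem integrable_cexp_conv {μ ν : Measure ℝ} [SFinite ν] {q : ℂ}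
    (hμ : Integrable (fun x : ℝ => Complex.exp (-(q * x))) μ)
    (hν : Integrable (fun x : ℝ => Complex.exp (-(q * x))) ν) :
    Integrable (fun x : ℝ => Complex.exp (-(q * x))) (μ.conv ν) := by
  rw [integrable_cexp_iff] at *
  rw [lintegral_enorm_cexp_conv]
  exact ENNReal.mul_lt_top hμ hν

theorem integral_cexp_conv {μ ν : Measure ℝ} [SFinite μ] [SFinite ν] {q : ℂ}
    (hμ : Integrable (fun x : ℝ => Complex.exp (-(q * x))) μ)
    (hν : Integrable (fun x : ℝ => Complex.exp (-(q * x))) ν) :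
    ∫ x : ℝ, Complex.exp (-(q * x)) ∂(μ.conv ν) =
      (∫ x : ℝ, Complex.exp (-(q * x)) ∂μ) * ∫ x : ℝ, Complex.exp (-(q * x)) ∂ν := by
  rw [integral_conv (integrable_cexp_conv hμ hν)]
  simp only [cexp_neg_mul_add, integral_const_mul, integral_mul_const]

/-- Convolution powers of a measure on the line. -/
def convPow (ν : Measure ℝ) : ℕ → Measure ℝ
  | 0 => Measure.dirac 0
  | n + 1 => (convPow ν n).conv ν

theorem isFiniteMeasure_convPow (ν : Measure ℝ) [IsFiniteMeasure ν] (n : ℕ) :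
    IsFiniteMeasure (convPow ν n) := by
  induction n with
  | zero => rw [convPow]; infer_instance
  | succ n ih => rw [convPow]; infer_instance

theorem ae_nonneg_convPow {ν : Measure ℝ} [IsFiniteMeasure ν] (hν : ∀ᵐ x ∂ν, 0 ≤ x) (n : ℕ) :
    ∀ᵐ x ∂(convPow ν n), 0 ≤ x := by
  induction n with
  | zero => rw [convPow, ae_dirac_eq]; simp
  | succ n ih => exact ae_nonneg_conv ih hν

theorem lintegral_enorm_cexp_convPow (ν : Measure ℝ) [IsFiniteMeasure ν] (q : ℂ) (n : ℕ) :
    ∫⁻ x : ℝ, ‖Complex.exp (-(q * x))‖ₑ ∂(convPow ν n) =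
      (∫⁻ x : ℝ, ‖Complex.exp (-(q * x))‖ₑ ∂ν) ^ n := by
  induction n with
  | zero => simp [convPow]
  | succ n ih => rw [convPow, lintegral_enorm_cexp_conv, ih, pow_succ]

theorem integral_cexp_convPow {ν : Measure ℝ} [IsFiniteMeasure ν] {q : ℂ}
    (hν : Integrable (fun x : ℝ => Complex.exp (-(q * x))) ν) (n : ℕ) :
    Integrable (fun x : ℝ => Complex.exp (-(q * x))) (convPow ν n) ∧
    ∫ x : ℝ, Complex.exp (-(q * x)) ∂(convPow ν n) =
      (∫ x : ℝ, Complex.exp (-(q * x)) ∂ν) ^ n := by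
  have : ∀ n, IsFiniteMeasure (convPow ν n) := isFiniteMeasure_convPow ν
  induction n with
  | zero => exact ⟨by simp [convPow, integrable_dirac], by simp [convPow]⟩
  | succ n ih =>
    exact ⟨integrable_cexp_conv ih.1 hν, by rw [convPow, integral_cexp_conv ih.1 hν, ih.2, pow_succ]⟩

theorem tsum_ofReal_exp_neg_div_factorial (l : ℝ) {A : ENNReal} (hA : A < ⊤) :
    ∑' n : ℕ, ENNReal.ofReal (Real.exp (-l) / n.factorial) * A ^ n =
      ENNReal.ofReal (Real.exp (-l) * Real.exp A.toReal) := by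
  have h1 : HasSum (fun n : ℕ => Real.exp (-l) / n.factorial * A.toReal ^ n)
      (Real.exp (-l) * Real.exp A.toReal) := by
    have := (NormedSpace.expSeries_div_hasSum_exp (𝔸 := ℝ) A.toReal).mul_left (Real.exp (-l))
    rw [← Real.exp_eq_exp_ℝ] at this
    refine this.congr_fun ?_
    intro n
    ring
  rw [← h1.tsum_eq, ENNReal.ofReal_tsum_of_nonneg (fun n => by positivity) h1.summable]
  refine tsum_congr fun n => ?_
  rw [ENNReal.ofReal_mul (by positivity), ENNReal.ofReal_pow ENNReal.toReal_nonneg,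
    ENNReal.ofReal_toReal hA.ne]

/-- The compound Poisson distribution with a given finite Lévy measure. -/
def compoundPoisson (ν : Measure ℝ) : Measure ℝ :=
  Measure.sum fun n : ℕ => ENNReal.ofReal (Real.exp (-ν.real univ) / n.factorial) • convPow ν n

section CompoundPoisson

variable {ν : Measure ℝ} [IsFiniteMeasure ν]

theorem lintegral_enorm_cexp_compoundPoisson {q : ℂ}
    (hν : Integrable (fun x : ℝ => Complex.exp (-(q * x))) ν) :
    ∫⁻ x : ℝ, ‖Complex.exp (-(q * x))‖ₑ ∂(compoundPoisson ν) =
      ENNReal.ofReal (Real.exp (-ν.real univ) *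
        Real.exp (∫⁻ x : ℝ, ‖Complex.exp (-(q * x))‖ₑ ∂ν).toReal) := by
  rw [compoundPoisson, lintegral_sum_measure,
    ← tsum_ofReal_exp_neg_div_factorial _ ((integrable_cexp_iff ν q).1 hν)]
  refine tsum_congr fun n => ?_
  rw [lintegral_smul_measure, lintegral_enorm_cexp_convPow, smul_eq_mul]

theorem isProbabilityMeasure_compoundPoisson : IsProbabilityMeasure (compoundPoisson ν) := by
  constructor
  have := lintegral_enorm_cexp_compoundPoisson (ν := ν) (q := 0) (by simp)
  simp only [zero_mul, neg_zero, Complex.exp_zero, enorm_one, lintegral_one] at this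
  rw [this, Measure.real, ← Real.exp_add, neg_add_cancel, Real.exp_zero, ENNReal.ofReal_one]

theorem ae_nonneg_compoundPoisson (hν : ∀ᵐ x ∂ν, 0 ≤ x) :
    ∀ᵐ x ∂(compoundPoisson ν), 0 ≤ x := by
  rw [compoundPoisson, Measure.ae_sum_iff]
  exact fun n => Measure.ae_smul_measure (ae_nonneg_convPow hν n) _

/-- Convolution powers become powers of the Laplace transform, and the Poisson weights sum them to
an exponential. -/
theorem integral_cexp_compoundPoisson {q : ℂ}
    (hν : Integrable (fun x : ℝ => Complex.exp (-(q * x))) ν) :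
    Integrable (fun x : ℝ => Complex.exp (-(q * x))) (compoundPoisson ν) ∧
    ∫ x : ℝ, Complex.exp (-(q * x)) ∂(compoundPoisson ν) =
      Complex.exp (∫ x : ℝ, (Complex.exp (-(q * x)) - 1) ∂ν) := by
  have hi : Integrable (fun x : ℝ => Complex.exp (-(q * x))) (compoundPoisson ν) := by
    rw [integrable_cexp_iff, lintegral_enorm_cexp_compoundPoisson hν]
    exact ENNReal.ofReal_lt_top
  refine ⟨hi, ?_⟩
  have h1 := hasSum_integral_measure hi
  have h2 := (NormedSpace.expSeries_div_hasSum_exp (𝔸 := ℂ)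
    (∫ x : ℝ, Complex.exp (-(q * x)) ∂ν)).mul_left (Complex.exp (-(ν.real univ : ℂ)))
  rw [← Complex.exp_eq_exp_ℂ, ← Complex.exp_add] at h2
  rw [integral_sub hν (integrable_const _)]
  simp only [integral_const, Complex.real_smul, mul_one]
  rw [sub_eq_neg_add]
  refine h1.unique (h2.congr_fun fun n => ?_)
  rw [integral_smul_measure, (integral_cexp_convPow hν n).2,
    ENNReal.toReal_ofReal (by positivity), Complex.real_smul]
  push_cast
  ring

end CompoundPoisson

/-! ### Measures with density and Gamma laws -/

/-- The measure on `(0, ∞)` with density `h`. -/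
def densityIoi (h : ℝ → ℝ) : Measure ℝ :=
  (volume.restrict (Ioi (0 : ℝ))).withDensity fun t => ENNReal.ofReal (h t)

section DensityIoi

variable {h : ℝ → ℝ}

theorem ae_nonneg_densityIoi : ∀ᵐ x ∂(densityIoi h), 0 ≤ x := by
  have h1 : ∀ᵐ x ∂(volume.restrict (Ioi (0 : ℝ))), 0 ≤ x := by
    filter_upwards [self_mem_ae_restrict measurableSet_Ioi] with x hx using le_of_lt hx
  exact (withDensity_absolutelyContinuous _ _) h1

theorem integrable_densityIoi_iff (hc : ContinuousOn h (Ioi 0)) (h0 : ∀ t ∈ Ioi (0 : ℝ), 0 ≤ h t)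
    (f : ℝ → ℂ) :
    Integrable f (densityIoi h) ↔ IntegrableOn (fun t => (h t : ℂ) * f t) (Ioi 0) := by
  have hm : AEMeasurable (fun t => ENNReal.ofReal (h t)) (volume.restrict (Ioi (0 : ℝ))) :=
    (hc.aemeasurable measurableSet_Ioi).ennreal_ofReal
  rw [densityIoi, integrable_withDensity_iff_integrable_smul₀' hm
    (Eventually.of_forall fun _ => ENNReal.ofReal_lt_top)]
  refine integrable_congr ?_
  filter_upwards [self_mem_ae_restrict measurableSet_Ioi] with t ht
  rw [ENNReal.toReal_ofReal (h0 t ht), Complex.real_smul]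

theorem integral_densityIoi (hc : ContinuousOn h (Ioi 0)) (h0 : ∀ t ∈ Ioi (0 : ℝ), 0 ≤ h t)
    (f : ℝ → ℂ) : ∫ t, f t ∂(densityIoi h) = ∫ t in Ioi (0 : ℝ), (h t : ℂ) * f t := by
  have hm : AEMeasurable (fun t => ENNReal.ofReal (h t)) (volume.restrict (Ioi (0 : ℝ))) :=
    (hc.aemeasurable measurableSet_Ioi).ennreal_ofReal
  rw [densityIoi, integral_withDensity_eq_integral_toReal_smul₀ hm
    (Eventually.of_forall fun _ => ENNReal.ofReal_lt_top)]
  refine setIntegral_congr_fun measurableSet_Ioi fun t ht => ?_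
  simp only [ENNReal.toReal_ofReal (h0 t ht), Complex.real_smul]

end DensityIoi

/-- The Gamma distribution (`δ₀` for shape `0`) and its Laplace transform. -/
theorem exists_gamma_distribution {C l : ℝ} (hC : 0 ≤ C) (hl : 0 < l) :
    ∃ π : Measure ℝ, IsProbabilityMeasure π ∧ (∀ᵐ x ∂π, 0 ≤ x) ∧ ∀ q : ℂ, -l < q.re →
      Integrable (fun x : ℝ => Complex.exp (-(q * x))) π ∧
      ∫ x : ℝ, Complex.exp (-(q * x)) ∂π =
        Complex.exp (C * (Complex.log l - Complex.log (q + l))) := by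
  rcases hC.eq_or_lt with rfl | hC
  · refine ⟨Measure.dirac 0, inferInstance, ?_, fun q _ => ⟨?_, ?_⟩⟩
    · rw [ae_dirac_eq]; simp
    · exact integrable_dirac (by simp)
    · simp
  set h : ℝ → ℝ := fun t => l ^ C / Real.Gamma C * (t ^ (C - 1) * Real.exp (-(l * t))) with hh
  have hG : 0 < Real.Gamma C := Real.Gamma_pos_of_pos hC
  have hc : ContinuousOn h (Ioi 0) := by
    refine continuousOn_const.mul (ContinuousOn.mul ?_ (by fun_prop))
    exact ContinuousOn.rpow_const continuousOn_id fun t ht => Or.inl (ne_of_gt ht)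
  have h0 : ∀ t ∈ Ioi (0 : ℝ), 0 ≤ h t := fun t ht => by
    have ht' : (0 : ℝ) ≤ t := le_of_lt ht
    have := Real.rpow_nonneg ht' (C - 1)
    positivity
  have hCre : 0 < (C : ℂ).re := by simpa using hC
  have hqre : ∀ q : ℂ, -l < q.re → 0 < (q + l).re := fun q hq => by
    simp only [Complex.add_re, Complex.ofReal_re]; linarith
  have heq : ∀ q : ℂ, EqOn (fun t : ℝ => ((l ^ C / Real.Gamma C : ℝ) : ℂ) *
      ((t : ℂ) ^ ((C : ℂ) - 1) * Complex.exp (-((q + l) * t))))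
      (fun t : ℝ => (h t : ℂ) * Complex.exp (-(q * t))) (Ioi 0) := by
    intro q t ht
    have e1 : Complex.exp (-((q + l) * t)) =
        Complex.exp (-(q * t)) * Complex.exp (-((l : ℂ) * t)) := by
      rw [← Complex.exp_add]; ring_nf
    have e2 : ((t ^ (C - 1) : ℝ) : ℂ) = (t : ℂ) ^ ((C : ℂ) - 1) := by
      rw [Complex.ofReal_cpow (le_of_lt ht)]; push_cast; rfl
    simp only [hh]
    rw [e1, Complex.ofReal_mul, Complex.ofReal_mul, e2]
    push_cast
    ring
  have hint : ∀ q : ℂ, -l < q.re →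
      Integrable (fun x : ℝ => Complex.exp (-(q * x))) (densityIoi h) ∧
      ∫ x : ℝ, Complex.exp (-(q * x)) ∂(densityIoi h) =
        Complex.exp (C * (Complex.log l - Complex.log (q + l))) := by
    intro q hq
    have hre := hqre q hq
    rw [integrable_densityIoi_iff hc h0, integral_densityIoi hc h0,
      ← integrableOn_congr_fun (heq q) measurableSet_Ioi,
      ← setIntegral_congr_fun measurableSet_Ioi (heq q), integral_const_mul,
      integral_cpow_mul_exp_neg_mul_Ioi_of_re_pos hCre hre]
    refine ⟨(integrableOn_cpow_mul_exp_neg_mul_Ioi hCre hre).const_mul _, ?_⟩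
    have hne : q + l ≠ 0 := by intro h; simp [h] at hre
    have hG' : (Real.Gamma C : ℂ) ≠ 0 := by exact_mod_cast hG.ne'
    have hl' : (l : ℂ) ≠ 0 := by exact_mod_cast hl.ne'
    have harg : (q + l).arg ≠ Real.pi := by
      intro h
      rw [Complex.arg_eq_pi_iff] at h
      linarith [h.1]
    rw [Complex.Gamma_ofReal, Complex.ofReal_div, Complex.ofReal_cpow hl.le,
      Complex.cpow_def_of_ne_zero (one_div_ne_zero hne), Complex.cpow_def_of_ne_zero hl',
      one_div, Complex.log_inv _ harg, mul_sub, Complex.exp_sub]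
    rw [show -Complex.log (q + l) * C = -(C * Complex.log (q + l)) by ring, Complex.exp_neg,
      mul_comm (Complex.log (l : ℂ))]
    field_simp
  refine ⟨densityIoi h, ⟨?_⟩, ae_nonneg_densityIoi, hint⟩
  -- The transform at `q = 0` is the total mass, and the formula there equals 1.
  obtain ⟨i1, i2⟩ := hint 0 (by simpa using hl)
  simp only [zero_mul, neg_zero, Complex.exp_zero, zero_add, sub_self, mul_zero] at i1 i2
  have hf : IsFiniteMeasure (densityIoi h) := by
    rw [integrable_const_iff] at i1
    simpa [isFiniteMeasure_iff] using i1
  simp only [integral_const, Complex.real_smul, mul_one] at i2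
  have i3 : (densityIoi h).real univ = 1 := by exact_mod_cast i2
  rw [Measure.real, ENNReal.toReal_eq_one_iff] at i3
  exact i3

/-! ### Existence and uniqueness of the Barnes beta distribution -/

section Existence

variable {M N : ℕ} {a : Fin M → ℝ} {b : Fin (N + 1) → ℝ}

/-- The value at `0+` of `barnesLevy a b` for `M ≤ N`. -/
def barnesLevyLimit {M N : ℕ} (a : Fin M → ℝ) (b : Fin (N + 1) → ℝ) : ℝ :=
  0 ^ (N - M) * (∏ k : Fin N, b k.succ) * ∏ j, (a j)⁻¹

theorem barnesLevyLimit_nonneg (ha : ∀ j, 0 < a j) (hb : ∀ k, 0 < b k) :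
    0 ≤ barnesLevyLimit a b :=
  mul_nonneg (mul_nonneg (by positivity) (Finset.prod_nonneg fun k _ => (hb _).le))
    (Finset.prod_nonneg fun j _ => (inv_pos.2 (ha j)).le)

/-- Multiply the bounds `x e^{-x} ≤ 1 - e^{-x} ≤ x` over all factors: the exponentials collect to
the rate `∑ b_k`, which is why the Gamma part gets that rate. If `M < N` the limit is `0`; if `M =
N` it is positive, by `0 ^ 0 = 1`. -/
theorem barnesLevyLimit_mul_exp_le (ha : ∀ j, 0 < a j) (hb : ∀ k, 0 < b k) (hMN : M ≤ N) {t : ℝ}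
    (ht : 0 < t) : barnesLevyLimit a b * Real.exp (-((∑ k, b k) * t)) ≤ barnesLevy a b t := by
  have h1 : ∀ k : Fin N, b k.succ * t * Real.exp (-(b k.succ * t)) ≤
      1 - Real.exp (-(b k.succ * t)) := fun k => by
    have h2 := mul_le_mul_of_nonneg_right (Real.add_one_le_exp (b k.succ * t))
      (Real.exp_pos (-(b k.succ * t))).le
    rw [← Real.exp_add, add_neg_cancel, Real.exp_zero] at h2
    linarith
  have h2 : ∀ j : Fin M, (a j * t)⁻¹ ≤ (1 - Real.exp (-(a j * t)))⁻¹ := fun j =>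
    inv_anti₀ (one_sub_exp_neg_mul_pos (ha j) ht)
      (by linarith [Real.add_one_le_exp (-(a j * t))])
  have h3 : ∀ k : Fin N, 0 ≤ b k.succ * t * Real.exp (-(b k.succ * t)) := fun k => by
    have := (hb k.succ).le
    positivity
  have h4 : ∀ j : Fin M, 0 ≤ (a j * t)⁻¹ := fun j => by
    have := (ha j).le
    positivity
  have h5 : Real.exp (-(b 0 * t)) * (∏ k : Fin N, (b k.succ * t * Real.exp (-(b k.succ * t)))) *
      ∏ j, (a j * t)⁻¹ ≤ barnesLevy a b t := by
    refine mul_le_mul (mul_le_mul_of_nonneg_left (Finset.prod_le_prod (fun k _ => h3 k)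
      fun k _ => h1 k) (Real.exp_pos _).le) (Finset.prod_le_prod (fun j _ => h4 j)
      fun j _ => h2 j) (Finset.prod_nonneg fun j _ => h4 j) ?_
    exact mul_nonneg (Real.exp_pos _).le (Finset.prod_nonneg fun k _ => (h3 k).trans (h1 k))
  have h9 : t ^ (N - M) * (∏ k : Fin N, b k.succ) * (∏ j, (a j)⁻¹) *
      Real.exp (-((∑ k, b k) * t)) =
      Real.exp (-(b 0 * t)) * (∏ k : Fin N, (b k.succ * t * Real.exp (-(b k.succ * t)))) *
      ∏ j, (a j * t)⁻¹ := by
    have e1 : Real.exp (-((∑ k, b k) * t)) =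
        Real.exp (-(b 0 * t)) * ∏ k : Fin N, Real.exp (-(b k.succ * t)) := by
      rw [← Real.exp_sum, ← Real.exp_add, Fin.sum_univ_succ, Finset.sum_neg_distrib,
        ← Finset.sum_mul]
      ring_nf
    have e2 : t ^ N = t ^ (N - M) * t ^ M := by rw [← pow_add, Nat.sub_add_cancel hMN]
    have e3 : t ^ M ≠ 0 := pow_ne_zero _ ht.ne'
    simp only [mul_inv, Finset.prod_mul_distrib, Finset.prod_const, Finset.card_univ,
      Fintype.card_fin, e1, e2, inv_pow]
    field_simp
  refine le_trans ?_ (h9.le.trans h5)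
  have h6 : (0 : ℝ) ^ (N - M) ≤ t ^ (N - M) := pow_le_pow_left₀ le_rfl ht.le _
  have h7 : 0 ≤ ∏ k : Fin N, b k.succ := Finset.prod_nonneg fun k _ => (hb _).le
  have h8 : 0 ≤ ∏ j, (a j)⁻¹ := Finset.prod_nonneg fun j _ => (inv_pos.2 (ha j)).le
  unfold barnesLevyLimit
  gcongr

/-- The Lévy density of `-log β_{M,N}(a, b)` with its Gamma part removed. -/
def barnesLevyRemainder {M N : ℕ} (a : Fin M → ℝ) (b : Fin (N + 1) → ℝ) (t : ℝ) : ℝ :=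
  (barnesLevy a b t - barnesLevyLimit a b * Real.exp (-((∑ k, b k) * t))) / t

theorem barnesLevyRemainder_nonneg (ha : ∀ j, 0 < a j) (hb : ∀ k, 0 < b k) (hMN : M ≤ N) :
    ∀ t ∈ Ioi (0 : ℝ), 0 ≤ barnesLevyRemainder a b t := fun _ ht =>
  div_nonneg (sub_nonneg.2 (barnesLevyLimit_mul_exp_le ha hb hMN ht)) (le_of_lt ht)

theorem continuousOn_barnesLevyRemainder (ha : ∀ j, 0 < a j) :
    ContinuousOn (barnesLevyRemainder a b) (Ioi 0) := by
  unfold barnesLevyRemainder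
  exact ((continuousOn_barnesLevy ha).sub (by fun_prop)).div continuousOn_id
    fun t ht => ne_of_gt ht

/-- The numerator extends differentiably to `0` and vanishes there, so it is `O(t)`. Hence the
remainder has finite mass near `0`. -/
theorem barnesLevyRemainder_isBigO_zero (ha : ∀ j, 0 < a j) (hMN : M ≤ N) :
    barnesLevyRemainder a b =O[𝓝[>] 0] fun _ => (1 : ℝ) := by
  set g : ℝ → ℝ := fun t => Real.exp (-(b 0 * t)) * t ^ (N - M) *
    (∏ k : Fin N, expSlope (b k.succ) t) * ∏ j, (expSlope (a j) t)⁻¹ with hg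
  have hd : DifferentiableAt ℝ
      (fun t => g t - barnesLevyLimit a b * Real.exp (-((∑ k, b k) * t))) 0 :=
    (analyticAt_barnesLevy_extension ha).differentiableAt.sub (by fun_prop)
  have h0 : g 0 - barnesLevyLimit a b * Real.exp (-((∑ k, b k) * 0)) = 0 := by
    simp [hg, barnesLevyLimit, expSlope_zero]
  have h1 := hd.isBigO_sub.mono (nhdsWithin_le_nhds (s := Ioi 0))
  simp only [h0, sub_zero] at h1
  have h2 := h1.mul (isBigO_refl (fun t : ℝ => t⁻¹) (𝓝[>] 0))
  refine h2.congr' ?_ ?_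
  · filter_upwards [self_mem_nhdsWithin] with t ht
    rw [barnesLevyRemainder, barnesLevy_eq_extension hMN (ne_of_gt ht), div_eq_mul_inv]
  · filter_upwards [self_mem_nhdsWithin] with t ht
    exact mul_inv_cancel₀ (ne_of_gt ht)

theorem le_sum_of_pos (hb : ∀ k, 0 < b k) : b 0 ≤ ∑ k, b k :=
  Finset.single_le_sum (fun k _ => (hb k).le) (Finset.mem_univ 0)

theorem integrableOn_barnesLevyRemainder (ha : ∀ j, 0 < a j) (hb : ∀ k, 0 < b k) (hMN : M ≤ N)
    {q : ℂ} (hq : -b 0 < q.re) :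
    IntegrableOn (fun t : ℝ => (barnesLevyRemainder a b t : ℂ) * Complex.exp (-(q * t)))
      (Ioi 0) := by
  have hε : 0 < b 0 + q.re := by linarith
  have hexp : Continuous fun t : ℝ => Complex.exp (-(q * t)) := by fun_prop
  -- At `s = 1` the Mellin weight `t^{s-1}` is trivial, so convergence there is plain integrability.
  have key : MellinConvergent
      (fun t : ℝ => (barnesLevyRemainder a b t : ℂ) * Complex.exp (-(q * t))) 1 := by
    refine mellinConvergent_of_isBigO_rpow_exp (half_pos hε) (b := 0) ?_ ?_ ?_ (by simp)
    · exact ((Complex.continuous_ofReal.comp_continuousOn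
        (continuousOn_barnesLevyRemainder ha)).mul
          hexp.continuousOn).locallyIntegrableOn measurableSet_Ioi
    · have h1 := isBigO_cexp_mul_barnesLevy_atTop (q := q) ha hb (half_lt_self hε)
      have h2 : (fun t : ℝ => Complex.exp (-((q + (∑ k, b k : ℝ)) * t)) *
          (barnesLevyLimit a b : ℂ)) =O[atTop]
          fun t : ℝ => Real.exp (-((b 0 + q.re) / 2) * t) :=
        isBigO_cexp_neg_mul_atTop (n := 0)
          (by rw [Complex.add_re, Complex.ofReal_re]; linarith [le_sum_of_pos hb])
          ((isBigO_const_const _ (one_ne_zero (α := ℝ)) _).congr_right fun t => by simp)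
      have h3 : (fun t : ℝ => ((t : ℂ))⁻¹) =O[atTop] fun _ => (1 : ℝ) := by
        refine IsBigO.of_bound 1 ((eventually_ge_atTop 1).mono fun t ht => ?_)
        rw [norm_inv, Complex.norm_real, Real.norm_eq_abs, abs_of_pos (by linarith)]
        simpa using inv_le_one_of_one_le₀ ht
      refine ((h1.sub h2).mul h3).congr (fun t => ?_) (fun t => mul_one _)
      have e1 : Complex.exp (-((q + (∑ k, b k : ℝ)) * t)) =
          Complex.exp (-(q * t)) * Complex.exp (-((∑ k, b k : ℝ) * t)) := by
        rw [← Complex.exp_add]; ring_nf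
      rw [e1, barnesLevyRemainder]
      push_cast
      ring
    · have h1 : (fun t : ℝ => Complex.exp (-(q * t))) =O[𝓝[>] 0] fun _ => (1 : ℝ) :=
        (hexp.tendsto 0).isBigO_one ℝ |>.mono nhdsWithin_le_nhds
      refine ((isBigO_ofReal_comp (barnesLevyRemainder_isBigO_zero ha hMN)).mul h1).congr_right
        fun t => by simp
  simpa [MellinConvergent] using key

/-- Frullani's integral, as the case `M = N = 0` of `integral_barnesLevy`. -/
theorem integral_exp_sub_one_mul_exp_div {l : ℝ} (hl : 0 < l) {q : ℂ} (hq : -l < q.re) :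
    IntegrableOn (fun t : ℝ => (Complex.exp (-(q * t)) - 1) *
      ((Real.exp (-(l * t)) / t : ℝ) : ℂ)) (Ioi 0) ∧
    ∫ t in Ioi (0 : ℝ), (Complex.exp (-(q * t)) - 1) * ((Real.exp (-(l * t)) / t : ℝ) : ℂ) =
      Complex.log l - Complex.log (q + l) := by
  have hql : 0 < (q + l).re := by rw [Complex.add_re, Complex.ofReal_re]; linarith
  have h := integral_barnesLevy (M := 0) (N := 0) (a := Fin.elim0) (b := fun _ => l)
    (fun j => j.elim0) (fun _ => hl) le_rfl hq
  have e : ∀ t, barnesLevy (M := 0) (N := 0) Fin.elim0 (fun _ => l) t = Real.exp (-(l * t)) :=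
    fun t => by simp [barnesLevy]
  simp only [e] at h
  refine ⟨h.1, h.2.symm.trans ?_⟩
  have e2 : ∀ (f : ℂ → ℂ) (p : ℂ), barnesS (N := 0) (fun _ => l) f p = f (p + l) := fun f p => by
    rw [barnesS, Fintype.sum_subsingleton _ ∅]; simp
  rw [e2, e2, barnesLogGamma_fin_zero _ hql,
    barnesLogGamma_fin_zero _ (by simpa using hl), zero_add]
  ring

/-- Lévy–Khintchine by hand: the law is a Gamma law convolved with a compound Poisson law.
Frullani's integral writes the Gamma exponent as an integral of `e^{-qt} - 1`, so the two Lévy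
densities add up to `barnesLevy a b t / t`. -/
theorem exists_law_neg_log_barnesBeta (ha : ∀ j, 0 < a j) (hb : ∀ k, 0 < b k) (hMN : M ≤ N) :
    ∃ π : Measure ℝ, IsProbabilityMeasure π ∧ (∀ᵐ x ∂π, 0 ≤ x) ∧ ∀ q : ℂ, -b 0 < q.re →
      Integrable (fun x : ℝ => Complex.exp (-(q * x))) π ∧
      ∫ x : ℝ, Complex.exp (-(q * x)) ∂π = barnesEta a b q := by
  have hl : 0 < ∑ k, b k := (hb 0).trans_le (le_sum_of_pos hb)
  obtain ⟨γ, hγ, hγ0, hγL⟩ := exists_gamma_distribution (barnesLevyLimit_nonneg ha hb) hl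
  set ν := densityIoi (barnesLevyRemainder a b)
  have hrc := continuousOn_barnesLevyRemainder (b := b) ha
  have hr0 := barnesLevyRemainder_nonneg ha hb hMN
  have hint : ∀ q : ℂ, -b 0 < q.re → Integrable (fun x : ℝ => Complex.exp (-(q * x))) ν :=
    fun q hq => (integrable_densityIoi_iff hrc hr0 _).2
      (integrableOn_barnesLevyRemainder ha hb hMN hq)
  have hν : IsFiniteMeasure ν := by
    have := hint 0 (by simpa using hb 0)
    simp only [zero_mul, neg_zero, Complex.exp_zero, integrable_const_iff, one_ne_zero,
      false_or] at this
    exact this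
  have hcp := isProbabilityMeasure_compoundPoisson (ν := ν)
  refine ⟨γ.conv (compoundPoisson ν), inferInstance,
    ae_nonneg_conv hγ0 (ae_nonneg_compoundPoisson ae_nonneg_densityIoi), fun q hq => ?_⟩
  have hql : -∑ k, b k < q.re := by linarith [le_sum_of_pos hb]
  obtain ⟨g1, g2⟩ := hγL q hql
  obtain ⟨c1, c2⟩ := integral_cexp_compoundPoisson (hint q hq)
  refine ⟨integrable_cexp_conv g1 c1, ?_⟩
  obtain ⟨f1, f2⟩ := integral_exp_sub_one_mul_exp_div hl hql
  obtain ⟨l1, l2⟩ := integral_barnesLevy ha hb hMN hq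
  rw [integral_cexp_conv g1 c1, g2, c2, ← Complex.exp_add, barnesEta, l2,
    integral_densityIoi hrc hr0, ← f2, ← integral_const_mul, ← integral_add (f1.const_mul _)]
  · congr 1
    refine setIntegral_congr_fun measurableSet_Ioi fun t _ => ?_
    simp only [barnesLevyRemainder]
    push_cast
    ring
  · have h0 := (hint q hq).sub (integrable_const (1 : ℂ))
    exact (integrable_densityIoi_iff hrc hr0 _).1 h0

theorem ofReal_exp_neg_cpow (x : ℝ) (q : ℂ) :
    ((Real.exp (-x) : ℝ) : ℂ) ^ q = Complex.exp (-(q * x)) := by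
  have h : ((Real.exp (-x) : ℝ) : ℂ) ≠ 0 := by exact_mod_cast (Real.exp_pos _).ne'
  rw [Complex.cpow_def_of_ne_zero h, ← Complex.ofReal_log (Real.exp_pos _).le, Real.log_exp]
  push_cast
  ring_nf

theorem exists_isBarnesBeta (ha : ∀ j, 0 < a j) (hb : ∀ k, 0 < b k) (hMN : M ≤ N) :
    ∃ μ : Measure ℝ, IsBarnesBeta a b μ := by
  obtain ⟨π, hπ, hπ0, h⟩ := exists_law_neg_log_barnesBeta ha hb hMN
  have hm : Measurable fun x : ℝ => Real.exp (-x) := by fun_prop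
  have hpow : ∀ q : ℂ, Measurable fun t : ℝ => (t : ℂ) ^ q := fun q =>
    Complex.measurable_ofReal.pow_const q
  refine ⟨π.map fun x => Real.exp (-x), Measure.isProbabilityMeasure_map hm.aemeasurable, ?_,
    fun q hq => ?_, fun q hq => ?_⟩
  · refine (ae_map_iff hm.aemeasurable (p := fun t => t ∈ Ioc (0 : ℝ) 1) measurableSet_Ioc).2 ?_
    filter_upwards [hπ0] with x hx
    exact ⟨Real.exp_pos _, Real.exp_le_one_iff.2 (by linarith)⟩
  · rw [integrable_map_measure (hpow q).aestronglyMeasurable hm.aemeasurable]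
    simpa only [Function.comp_def, ofReal_exp_neg_cpow] using (h q hq).1
  · rw [integral_map hm.aemeasurable (hpow q).aestronglyMeasurable]
    simpa only [ofReal_exp_neg_cpow] using (h q hq).2

theorem IsBarnesBeta.charFun_map_log {μ : Measure ℝ} (h : IsBarnesBeta a b μ) (hb : 0 < b 0)
    (θ : ℝ) : charFun (μ.map Real.log) θ = barnesEta a b (θ * Complex.I) := by
  rw [charFun_apply_real, integral_map Real.measurable_log.aemeasurable
    (by fun_prop), ← h.mellin_eq _ (by simpa using hb)]
  refine integral_congr_ae ?_
  filter_upwards [h.ae_mem] with t ht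
  have ht0 : (t : ℂ) ≠ 0 := by exact_mod_cast ht.1.ne'
  rw [Complex.cpow_def_of_ne_zero ht0, ← Complex.ofReal_log ht.1.le]
  ring_nf

/-- Because `b 0 > 0`, the imaginary axis lies in the domain of the Mellin transform; this fixes the
law of `log β`, and `exp` inverts `log` almost everywhere. -/
theorem IsBarnesBeta.unique {μ₁ μ₂ : Measure ℝ} (h₁ : IsBarnesBeta a b μ₁)
    (h₂ : IsBarnesBeta a b μ₂) (hb : 0 < b 0) : μ₁ = μ₂ := by
  have := h₁.isProbabilityMeasure
  have := h₂.isProbabilityMeasure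
  have hlog : μ₁.map Real.log = μ₂.map Real.log :=
    Measure.ext_of_charFun (funext fun θ => by
      rw [h₁.charFun_map_log hb, h₂.charFun_map_log hb])
  have key : ∀ μ : Measure ℝ, IsBarnesBeta a b μ → (μ.map Real.log).map Real.exp = μ := by
    intro μ h
    rw [Measure.map_map Real.measurable_exp Real.measurable_log]
    refine (Measure.map_congr ?_).trans Measure.map_id
    filter_upwards [h.ae_mem] with t ht
    exact Real.exp_log ht.1
  rw [← key μ₁ h₁, ← key μ₂ h₂, hlog]

end Existence

/-! ### Moments and the Laplace transform -/

section Laplace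

variable {m N : ℕ} {a : Fin (m + 1) → ℝ} {b : Fin (N + 1) → ℝ}

theorem barnesS_barnesLogGamma_sub_add (ha : ∀ j, 0 < a j) (hb : ∀ k, 0 < b k)
    (i : Fin (m + 1)) {q : ℂ} (hq : -b 0 < q.re) :
    barnesS b (barnesLogGamma a) q - barnesS b (barnesLogGamma a) (q + a i) =
      barnesS b (barnesLogGamma (fun j : Fin m => a (i.succAbove j))) q := by
  simp only [barnesS]
  rw [← Finset.sum_sub_distrib]
  refine Finset.sum_congr rfl fun K _ => ?_
  have hre : 0 < (q + (b 0 : ℂ) + ∑ k ∈ K, (b k.succ : ℂ)).re := by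
    have : 0 ≤ ∑ k ∈ K, b k.succ := Finset.sum_nonneg fun k _ => (hb _).le
    simp only [Complex.add_re, Complex.ofReal_re, Complex.re_sum]
    linarith
  rw [← barnesLogGamma_sub_add ha i hre, mul_sub]
  ring_nf

/-- The difference equation turns each summand into a difference of `𝒮_N L_M` at `l a_i` and `(l +
1) a_i`, and the sum telescopes. -/
theorem barnesMoment_eq_barnesEta (ha : ∀ j, 0 < a j) (hb : ∀ k, 0 < b k) (i : Fin (m + 1))
    (k : ℕ) : barnesMoment a b i k = barnesEta a b ((k : ℂ) * a i) := by
  rw [barnesMoment, barnesEta]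
  congr 1
  induction k with
  | zero => simp
  | succ k ih =>
    have hre : -b 0 < ((k : ℂ) * a i).re := by
      have h1 := mul_nonneg (Nat.cast_nonneg (α := ℝ) k) (ha i).le
      rw [Complex.re_mul_ofReal, Complex.natCast_re]
      linarith [hb 0]
    rw [Finset.sum_range_succ, neg_add, ih, ← barnesS_barnesLogGamma_sub_add ha hb i hre]
    push_cast
    rw [add_mul, one_mul]
    ring

theorem IsBarnesBeta.barnesMoment_eq {μ : Measure ℝ} (h : IsBarnesBeta a b μ)
    (ha : ∀ j, 0 < a j) (hb : ∀ k, 0 < b k) (i : Fin (m + 1)) (k : ℕ) :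
    barnesMoment a b i k = ∫ t : ℝ, (((t ^ a i) ^ k : ℝ) : ℂ) ∂μ := by
  have hre : -b 0 < ((k : ℂ) * a i).re := by
    have h1 := mul_nonneg (Nat.cast_nonneg (α := ℝ) k) (ha i).le
    rw [Complex.re_mul_ofReal, Complex.natCast_re]
    linarith [hb 0]
  rw [barnesMoment_eq_barnesEta ha hb, ← h.mellin_eq _ hre]
  refine integral_congr_ae ?_
  filter_upwards [h.ae_mem] with t ht
  rw [Complex.cpow_nat_mul, Complex.ofReal_pow, Complex.ofReal_cpow ht.1.le]

theorem IsBarnesBeta.ae_norm_rpow_pow_le_one {μ : Measure ℝ} (h : IsBarnesBeta a b μ)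
    (ha : ∀ j, 0 < a j) (i : Fin (m + 1)) (k : ℕ) :
    ∀ᵐ t ∂μ, ‖(((t ^ a i) ^ k : ℝ) : ℂ)‖ ≤ 1 := by
  filter_upwards [h.ae_mem] with t ht
  have h0 : 0 ≤ t ^ a i := Real.rpow_nonneg ht.1.le _
  rw [Complex.norm_real, Real.norm_of_nonneg (pow_nonneg h0 k)]
  exact pow_le_one₀ h0 (Real.rpow_le_one ht.1.le ht.2 (ha i).le)

/-- The bound comes from probability: existence of the distribution makes these numbers moments of a
variable in `(0, 1]`. -/
theorem norm_barnesMoment_le_one (ha : ∀ j, 0 < a j) (hb : ∀ k, 0 < b k) (hMN : m + 1 ≤ N)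
    (i : Fin (m + 1)) (k : ℕ) : ‖barnesMoment a b i k‖ ≤ 1 := by
  obtain ⟨μ, h⟩ := exists_isBarnesBeta ha hb hMN
  have := h.isProbabilityMeasure
  rw [h.barnesMoment_eq ha hb]
  simpa using norm_integral_le_of_norm_le_const (h.ae_norm_rpow_pow_le_one ha i k)

theorem radius_barnesLaplaceCoeff (ha : ∀ j, 0 < a j) (hb : ∀ k, 0 < b k) (hMN : m + 1 ≤ N)
    (i : Fin (m + 1)) :
    (FormalMultilinearSeries.ofScalars ℂ (barnesLaplaceCoeff a b i)).radius = ⊤ := by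
  refine FormalMultilinearSeries.radius_eq_top_of_summable_norm _ fun r => ?_
  refine Summable.of_nonneg_of_le (fun k => by positivity) (fun k => ?_)
    (Real.summable_pow_div_factorial r)
  rw [FormalMultilinearSeries.ofScalars_norm, barnesLaplaceCoeff, norm_mul, norm_div, norm_pow,
    norm_neg, norm_one, one_pow, Complex.norm_natCast, div_mul_eq_mul_div, one_mul,
    div_mul_eq_mul_div]
  gcongr
  exact mul_le_of_le_one_left (by positivity) (norm_barnesMoment_le_one ha hb hMN i k)

theorem IsBarnesBeta.integral_exp_eq_barnesLaplace {μ : Measure ℝ} (h : IsBarnesBeta a b μ)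
    (ha : ∀ j, 0 < a j) (hb : ∀ k, 0 < b k) (i : Fin (m + 1)) (x : ℝ) :
    ((∫ t : ℝ, Real.exp (-(x * t ^ a i)) ∂μ : ℝ) : ℂ) = barnesLaplace a b i x := by
  have := h.isProbabilityMeasure
  have hsum : HasSum (fun k : ℕ => ∫ t : ℝ, (-(x : ℂ)) ^ k / (k.factorial : ℂ) *
      (((t ^ a i) ^ k : ℝ) : ℂ) ∂μ) (∫ t : ℝ, ((Real.exp (-(x * t ^ a i)) : ℝ) : ℂ) ∂μ) := by
    -- As `t ^ a i ≤ 1` almost surely, the `k`-th term is dominated by a constant, and these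
    -- constants sum to `e^{|x|}`.
    refine hasSum_integral_of_dominated_convergence (fun k _ => |x| ^ k / k.factorial)
      (fun k => ?_) (fun k => ?_) ?_ ?_ ?_
    · exact (Measurable.aestronglyMeasurable (by fun_prop))
    · filter_upwards [h.ae_norm_rpow_pow_le_one ha i k] with t ht
      rw [norm_mul, norm_div, norm_pow, norm_neg, Complex.norm_real, Complex.norm_natCast,
        Real.norm_eq_abs]
      exact mul_le_of_le_one_right (by positivity) ht
    · exact Eventually.of_forall fun _ => Real.summable_pow_div_factorial |x|
    · exact integrable_const _
    · refine Eventually.of_forall fun t => ?_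
      have := NormedSpace.expSeries_div_hasSum_exp (𝔸 := ℂ) ((-(x * t ^ a i) : ℝ) : ℂ)
      rw [← Complex.exp_eq_exp_ℂ, ← Complex.ofReal_exp] at this
      refine this.congr_fun fun k => ?_
      push_cast
      rw [← neg_mul, mul_pow]
      ring
  rw [barnesLaplace, ← integral_complex_ofReal, ← hsum.tsum_eq]
  refine tsum_congr fun k => ?_
  rw [integral_const_mul, h.barnesMoment_eq ha hb]

theorem IsBarnesBeta.laplace_pos {μ : Measure ℝ} (h : IsBarnesBeta a b μ)
    (i : Fin (m + 1)) {x : ℝ} (hx : 0 < x) :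
    0 < ∫ t : ℝ, Real.exp (-(x * t ^ a i)) ∂μ := by
  have := h.isProbabilityMeasure
  refine integral_exp_pos ?_
  refine Integrable.of_bound (C := 1) (Measurable.aestronglyMeasurable (by fun_prop)) ?_
  filter_upwards [h.ae_mem] with t ht
  rw [Real.norm_of_nonneg (Real.exp_pos _).le]
  exact Real.exp_le_one_iff.2
    (neg_nonpos.2 (mul_nonneg hx.le (Real.rpow_nonneg ht.1.le _)))

end Laplace

end

theorem mainTheorem8 (m N : ℕ) (hMN : m + 1 ≤ N)
    (a : Fin (m + 1) → ℝ) (ha : ∀ j, 0 < a j)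
    (b : Fin (N + 1) → ℝ) (hb : ∀ k, 0 < b k) (i : Fin (m + 1)) :
    (FormalMultilinearSeries.ofScalars ℂ (barnesLaplaceCoeff a b i)).radius = ⊤ ∧
    (∃! μ : MeasureTheory.Measure ℝ, IsBarnesBeta a b μ) ∧
    (∀ μ : MeasureTheory.Measure ℝ, IsBarnesBeta a b μ → ∀ x : ℝ, 0 < x →
      ((∫ t : ℝ, Real.exp (-(x * t ^ (a i))) ∂μ : ℝ) : ℂ) = barnesLaplace a b i (x : ℂ)) ∧
    (∀ x : ℝ, 0 < x →
      (barnesLaplace a b i (x : ℂ)).im = 0 ∧ 0 < (barnesLaplace a b i (x : ℂ)).re) := by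
  obtain ⟨μ, hμ⟩ := exists_isBarnesBeta ha hb hMN
  refine ⟨radius_barnesLaplaceCoeff ha hb hMN i, ⟨μ, hμ, fun μ' h => h.unique hμ (hb 0)⟩,
    fun μ h x _ => h.integral_exp_eq_barnesLaplace ha hb i x, fun x hx => ?_⟩
  rw [← hμ.integral_exp_eq_barnesLaplace ha hb i x]
  exact ⟨Complex.ofReal_im _, hμ.laplace_pos i hx⟩
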